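/- Let $d \ge 1$ and let $\alpha = (\alpha_1,\dots,\alpha_d)$ be a probability distribution on $[d]=\{1,\dots,d\}$ that is sorted, i.e. $\alpha_1 \ge \alpha_2 \ge \cdots \ge \alpha_d \ge 0$. For $n \in \mathbb{N}$ let $w = (w_1,\dots,w_n)$ be a random word whose letters are drawn independently from $[d]$ according to $\alpha$, and let $\lambda^{(n)} = (\lambda^{(n)}_1 \ge \cdots \ge \lambda^{(n)}_d)$ be the shape (vector of row lengths) of the Young tableaux that the Robinson–Schensted–Knuth (RSK) algorithm assigns to $w$; the law of $\lambda^{(n)}$ is called the Schur–Weyl distribution. For $k \in [d]$ define $$\mathrm{Exc}^{(n)}_k(\alpha) = \mathbb{E}\Bigl[\sum_{i=1}^k \lambda^{(n)}_i\Bigr] - n\sum_{i=1}^k \alpha_i, \qquad \mathrm{ITW}_k(\alpha) = \sum_{i \le k < j} \frac{\alpha_j}{\alpha_i - \alpha_j} \in [0,\infty],$$ where $1 \le i \le k < j \le d$ in the last sum and a summand with $\alpha_i = \alpha_j$ is read as $+\infty$. Then for every $k \in [d]$: 1. $\mathrm{Exc}^{(n)}_k(\alpha) \le \mathrm{ITW}_k(\alpha)$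 for all $n \in \mathbb{N}$. 2. If $\alpha_1,\dots,\alpha_d$ are distinct, then $\mathrm{Exc}^{(n)}_k(\alpha) \nearrow \mathrm{ITW}_k(\alpha)$ as $n \to \infty$; that is, $\mathrm{Exc}^{(n)}_k(\alpha)$ is nondecreasing in $n$ and converges to $\mathrm{ITW}_k(\alpha)$. -/

import Mathlib

open MeasureTheory Filter Topology

/-- Row insertion of the letter `x` into a (weakly increasing) row: `x` replaces the leftmost
entry that is strictly larger than `x`, and that entry is bumped; if there is none, then `x` is
appended at the end of the row and nothing is bumped.  Returns the new row and the bumped letter. -/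
def rowInsert {A : Type*} [LinearOrder A] (x : A) : List A → List A × Option A
  | [] => ([x], none)
  | y :: r =>
      if x < y then (x :: r, some y)
      else (y :: (rowInsert x r).1, (rowInsert x r).2)

/-- Insertion of a letter into a tableau (the list of its rows, from the first row on): insert it
into the first row, insert the bumped letter, if any, into the second row, and so on. -/
def tableauInsert {A : Type*} [LinearOrder A] : List (List A) → A → List (List A)
  | [], x => [[x]]
  | r :: T, x =>
      match (rowInsert x r).2 with
      | none => (rowInsert x r).1 :: T
      | some y => (rowInsert x r).1 :: tableauInsert T y

/-- The insertion tableau of a word under the RSK algorithm: insert the letters of the word one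
after the other, from left to right, into the initially empty tableau. -/
def insertionTableau {A : Type*} [LinearOrder A] (w : List A) : List (List A) :=
  w.foldl tableauInsert []

/-- The shape `(λ₁, …, λ_d)` of the RSK tableaux of a word `w` of length `n` over the alphabet
`Fin d`, as the vector of its row lengths (a tableau over `Fin d` has at most `d` rows; absent rows
have length `0`). -/
def shRSK {n d : ℕ} (w : Fin n → Fin d) : Fin d → ℕ :=
  fun i => ((insertionTableau (List.ofFn w)).getD (i : ℕ) []).length

noncomputable section

/-- The law of one letter: the letter `i` has probability `α i`. -/
def letterLaw {d : ℕ} (α : Fin d → ℝ) : Measure (Fin d) :=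
  ∑ i, ENNReal.ofReal (α i) • Measure.dirac i

/-- The law of the `n`-letter `α`-random word, whose letters are independent with law `α`. -/
def wordLaw {d : ℕ} (n : ℕ) (α : Fin d → ℝ) : Measure (Fin n → Fin d) :=
  Measure.pi fun _ => letterLaw α

/-- The Schur–Weyl distribution: the law of the RSK shape of an `n`-letter `α`-random word. -/
def schurWeyl {d : ℕ} (n : ℕ) (α : Fin d → ℝ) : Measure (Fin d → ℕ) :=
  (wordLaw n α).map shRSK

/-- The excess `E[(λ₁ + ⋯ + λ_k) - (α₁ + ⋯ + α_k) n]` for `λ` drawn from the Schur–Weyl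
distribution.  Here `k : Fin d`, and `Finset.Iic k` is the set of the indices `i ≤ k`. -/
def excess {d : ℕ} (n : ℕ) (k : Fin d) (α : Fin d → ℝ) : ℝ :=
  ∫ l, ((∑ i ∈ Finset.Iic k, (l i : ℝ)) - (∑ i ∈ Finset.Iic k, α i) * (n : ℝ)) ∂(schurWeyl n α)

open Classical in
/-- The quantity `∑_{i ≤ k < j} α_j / (α_i - α_j)`, in the extended reals: a summand
whose denominator vanishes is `+∞`. -/
def itwBound {d : ℕ} (k : Fin d) (α : Fin d → ℝ) : EReal :=
  ∑ i ∈ Finset.Iic k, ∑ j ∈ Finset.Ioi k,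
    if α i = α j then (⊤ : EReal) else ((α j / (α i - α j) : ℝ) : EReal)

end

/-!
Let `D` be the number of letters larger than `k` in the rows `i ≤ k` of the insertion tableau of a
random word. These rows also contain all the letters up to `k`, so the excess is the mean of `D`.

The numbers of letters `j` in row `i < j` of the tableau evolve as queues in tandem, passed by the
letter that is inserted and bumped from row to row. A passage through one queue is an involution
which preserves the product of geometric laws with ratios `α j / α i` and the law `α` of an
independent token. Hence this product law is stationary when `α` is strictly decreasing, and the
mean of `D` under it is the sum of `α j / (α i - α j)` over `i ≤ k < j`.

By Greene's theorem, `D` does not decrease when a letter is put in front of the word. Hence the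
excess is nondecreasing in `n`, and a run from the empty tableau has a smaller mean of `D` than a
stationary one. Every state of positive stationary weight is reached from the empty tableau by some
word, so the means of truncations of `D` have the same limit from every such state, which must be
the stationary mean. The bound in the presence of ties follows by continuity in `α`.
-/

/-! ### Row insertion -/

section Insertion

variable {A : Type*} [LinearOrder A]

theorem rowInsert_snd (x : A) (r : List A) : (rowInsert x r).2 = r.find? (x < ·) := by
  induction r with
  | nil => rfl
  | cons a r ih => by_cases hx : x < a <;> simp [rowInsert, hx, ih]

theorem lt_of_rowInsert_snd_eq_some {x y : A} {r : List A} (h : (rowInsert x r).2 = some y) :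
    x < y := by
  rw [rowInsert_snd] at h
  simpa using List.find?_some h

theorem rowInsert_perm (x : A) (r : List A) :
    ((rowInsert x r).2.toList ++ (rowInsert x r).1).Perm (x :: r) := by
  induction r with
  | nil => simp [rowInsert]
  | cons a r ih =>
    by_cases hx : x < a
    · simpa [rowInsert, hx] using List.Perm.swap x a r
    · simpa [rowInsert, hx] using
        List.perm_middle.trans ((ih.cons a).trans (List.Perm.swap x a r))

theorem mem_of_mem_rowInsert {x z : A} {r : List A} (h : z ∈ (rowInsert x r).1) :
    z = x ∨ z ∈ r :=
  List.mem_cons.1 ((rowInsert_perm x r).subset (List.mem_append_right _ h))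

theorem exists_rowInsert_fst_eq_cons (x : A) (r : List A) :
    ∃ c t, (rowInsert x r).1 = c :: t ∧ c ≤ x := by
  cases r with
  | nil => exact ⟨x, [], rfl, le_rfl⟩
  | cons a r =>
    by_cases hx : x < a
    · exact ⟨x, r, by simp [rowInsert, hx], le_rfl⟩
    · exact ⟨a, (rowInsert x r).1, by simp [rowInsert, hx], not_lt.1 hx⟩

theorem rowInsert_sorted (x : A) {r : List A} (h : r.Pairwise (· ≤ ·)) :
    (rowInsert x r).1.Pairwise (· ≤ ·) := by
  induction r with
  | nil => simp [rowInsert]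
  | cons a r ih =>
    rw [List.pairwise_cons] at h
    by_cases hx : x < a
    · simp only [rowInsert, hx, if_true, List.pairwise_cons]
      exact ⟨fun b hb => hx.le.trans (h.1 b hb), h.2⟩
    · simp only [rowInsert, hx, if_false, List.pairwise_cons]
      refine ⟨fun b hb => ?_, ih h.2⟩
      rcases mem_of_mem_rowInsert hb with rfl | hb
      · exact not_lt.1 hx
      · exact h.1 b hb

theorem tableauInsert_eq (T : List (List A)) (x : A) :
    tableauInsert T x = (rowInsert x (T.headD [])).1 ::
      (rowInsert x (T.headD [])).2.elim T.tail (tableauInsert T.tail) := by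
  cases T with
  | nil => rfl
  | cons r T => cases h : (rowInsert x r).2 <;> simp [tableauInsert, h]

theorem insertionTableau_concat (w : List A) (x : A) :
    insertionTableau (w ++ [x]) = tableauInsert (insertionTableau w) x := by
  simp [insertionTableau]

/-- Column strictness of two adjacent rows of a tableau: the second row is not longer than the
first one, and each of its letters is larger than the letter above it. -/
def ColStrict : List A → List A → Prop
  | _, [] => True
  | [], _ :: _ => False
  | a :: r, b :: s => a < b ∧ ColStrict r s

/-- Semistandard tableaux, as lists of rows: the rows are weakly increasing and the columns are
strictly increasing. -/
structure IsTableau (T : List (List A)) : Prop where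
  sorted : ∀ r ∈ T, r.Pairwise (· ≤ ·)
  isChain : T.IsChain ColStrict

theorem colStrict_nil_right (r : List A) : ColStrict r [] := by
  cases r <;> trivial

theorem ColStrict.rowInsert_left {r s : List A} (h : ColStrict r s) (x : A) :
    ColStrict (rowInsert x r).1 s := by
  induction r generalizing s with
  | nil =>
    cases s with
    | nil => exact colStrict_nil_right _
    | cons b s => exact h.elim
  | cons a r ih =>
    cases s with
    | nil => exact colStrict_nil_right _
    | cons b s =>
      by_cases hx : x < a
      · simpa [rowInsert, hx] using ⟨hx.trans h.1, h.2⟩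
      · simpa [rowInsert, hx] using ⟨h.1, ih h.2⟩

theorem ColStrict.rowInsert_bump {x y : A} {r s : List A} (h : ColStrict r s)
    (hy : (rowInsert x r).2 = some y) : ColStrict (rowInsert x r).1 (rowInsert y s).1 := by
  induction r generalizing s with
  | nil => simp [rowInsert] at hy
  | cons a r ih =>
    have hxy : x < y := lt_of_rowInsert_snd_eq_some hy
    by_cases hx : x < a
    · obtain rfl : a = y := by simpa [rowInsert, hx] using hy
      cases s with
      | nil => simp [rowInsert, ColStrict, hx]
      | cons b s => simpa [rowInsert, h.1, ColStrict, hx] using h.2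
    · simp only [rowInsert, hx, if_false] at hy ⊢
      have hay : a < y := (not_lt.1 hx).trans_lt hxy
      cases s with
      | nil => simp [rowInsert, ColStrict, hay]
      | cons b s =>
        by_cases hyb : y < b
        · simpa [rowInsert, hyb] using ⟨hay, h.2.rowInsert_left x⟩
        · simpa [rowInsert, hyb] using ⟨h.1, ih h.2 hy⟩

theorem IsTableau.cons {r : List A} {T : List (List A)} (hT : IsTableau T)
    (hr : r.Pairwise (· ≤ ·)) (hrT : ColStrict r (T.headD [])) : IsTableau (r :: T) := by
  refine ⟨List.forall_mem_cons.2 ⟨hr, hT.sorted⟩, List.isChain_cons.2 ⟨?_, hT.isChain⟩⟩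
  cases T <;> simp_all

theorem IsTableau.tableauInsert {T : List (List A)} (h : IsTableau T) (x : A) :
    IsTableau (tableauInsert T x) := by
  induction T generalizing x with
  | nil => exact ⟨by simp [_root_.tableauInsert], by simp [_root_.tableauInsert]⟩
  | cons r T ih =>
    obtain ⟨hr, hT⟩ := List.forall_mem_cons.1 h.sorted
    have hrT : ColStrict r (T.headD []) := by
      cases T
      · exact colStrict_nil_right r
      · exact (List.isChain_cons_cons.1 h.isChain).1
    have htail : IsTableau T := ⟨hT, h.isChain.tail⟩
    rw [tableauInsert_eq]
    cases hy : (rowInsert x r).2 with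
    | none => simpa [hy] using htail.cons (rowInsert_sorted x hr) (hrT.rowInsert_left x)
    | some y =>
      simpa [hy] using (ih htail y).cons (rowInsert_sorted x hr)
        (by simpa [tableauInsert_eq] using hrT.rowInsert_bump hy)

theorem isTableau_insertionTableau (w : List A) : IsTableau (insertionTableau w) := by
  induction w using List.reverseRecOn with
  | nil => exact ⟨by simp [insertionTableau], by simp [insertionTableau]⟩
  | append_singleton w x ih =>
    rw [insertionTableau_concat]
    exact ih.tableauInsert x

end Insertion

/-! ### Knuth equivalence -/

/-- The row word of a tableau: the concatenation of its rows from the last to the first, a word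
whose insertion tableau is the given one. -/
def rowWord {A : Type*} (T : List (List A)) : List A := T.reverse.flatten

theorem rowWord_cons {A : Type*} (r : List A) (T : List (List A)) :
    rowWord (r :: T) = rowWord T ++ r := by
  simp [rowWord]

section Knuth

variable {A : Type*} [LinearOrder A]

/-- Knuth equivalence: the congruence on words generated by the two plactic relations
`y z x ~ y x z` for `x < y ≤ z` and `x z y ~ z x y` for `x ≤ y < z`. -/
inductive Knuth : List A → List A → Prop
  | refl (u) : Knuth u u
  | symm {u v} : Knuth u v → Knuth v u
  | trans {u v w} : Knuth u v → Knuth v w → Knuth u w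
  | swap_after {x y z : A} (p q : List A) (hxy : x < y) (hyz : y ≤ z) :
      Knuth (p ++ y :: z :: x :: q) (p ++ y :: x :: z :: q)
  | swap_before {x y z : A} (p q : List A) (hxy : x ≤ y) (hyz : y < z) :
      Knuth (p ++ x :: z :: y :: q) (p ++ z :: x :: y :: q)

theorem Knuth.append {u v : List A} (h : Knuth u v) (p q : List A) :
    Knuth (p ++ u ++ q) (p ++ v ++ q) := by
  induction h with
  | refl u => exact .refl _
  | symm _ ih => exact ih.symm
  | trans _ _ ih ih' => exact ih.trans ih'
  | swap_after p' q' hxy hyz => simpa using Knuth.swap_after (p ++ p') (q' ++ q) hxy hyz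
  | swap_before p' q' hxy hyz => simpa using Knuth.swap_before (p ++ p') (q' ++ q) hxy hyz

theorem Knuth.append_left {u v : List A} (h : Knuth u v) (p : List A) :
    Knuth (p ++ u) (p ++ v) := by simpa using h.append p []

theorem Knuth.append_right {u v : List A} (h : Knuth u v) (q : List A) :
    Knuth (u ++ q) (v ++ q) := by simpa using h.append [] q

theorem knuth_concat_of_lt {x y : A} {r : List A} (hx : x < y) (hr : (y :: r).Pairwise (· ≤ ·)) :
    Knuth (y :: r ++ [x]) (y :: x :: r) := by
  induction r generalizing y with
  | nil => exact .refl _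
  | cons a r ih =>
    have hya : y ≤ a := List.rel_of_pairwise_cons hr List.mem_cons_self
    exact ((ih (hx.trans_le hya) hr.of_cons).append_left [y]).trans (.swap_after [] r hx hya)

theorem knuth_rowInsert (x : A) {r : List A} (hr : r.Pairwise (· ≤ ·)) :
    Knuth (r ++ [x]) ((rowInsert x r).2.toList ++ (rowInsert x r).1) := by
  induction r with
  | nil => exact .refl _
  | cons y r ih =>
    by_cases hx : x < y
    · simpa [rowInsert, hx] using knuth_concat_of_lt hx hr
    · simp only [rowInsert, hx, if_false]
      refine ((ih hr.of_cons).append_left [y]).trans ?_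
      cases hb : (rowInsert x r).2 with
      | none => exact .refl _
      | some b =>
        obtain ⟨c, t, hct, hcx⟩ := exists_rowInsert_fst_eq_cons x r
        have hcb : c < b := hcx.trans_lt (lt_of_rowInsert_snd_eq_some hb)
        have hyc : y ≤ c := by
          rcases mem_of_mem_rowInsert (show c ∈ (rowInsert x r).1 by simp [hct]) with rfl | hc
          · exact not_lt.1 hx
          · exact List.rel_of_pairwise_cons hr hc
        rw [hct]
        exact .swap_before [] t hyc hcb

theorem knuth_tableauInsert {T : List (List A)} (hT : ∀ r ∈ T, r.Pairwise (· ≤ ·)) (x : A) :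
    Knuth (rowWord T ++ [x]) (rowWord (tableauInsert T x)) := by
  induction T generalizing x with
  | nil => exact .refl _
  | cons r T ih =>
    obtain ⟨hr, hT⟩ := List.forall_mem_cons.1 hT
    have hrow := (knuth_rowInsert x hr).append_left (rowWord T)
    rw [tableauInsert_eq, rowWord_cons, rowWord_cons, List.append_assoc]
    refine hrow.trans ?_
    rw [List.headD_cons, List.tail_cons]
    cases hy : (rowInsert x r).2 with
    | none => exact .refl _
    | some y => simpa using (ih hT y).append_right (rowInsert x r).1

theorem knuth_insertionTableau (w : List A) : Knuth w (rowWord (insertionTableau w)) := by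
  induction w using List.reverseRecOn with
  | nil => exact .refl _
  | append_singleton w x ih =>
    rw [insertionTableau_concat]
    exact (ih.append_right [x]).trans
      (knuth_tableauInsert (isTableau_insertionTableau w).sorted x)

end Knuth

/-! ### Greene's theorem -/

section Greene

variable {A : Type*}

/-- The number of cells in the first `k` rows of a tableau. -/
def topSize (k : ℕ) (T : List (List A)) : ℕ := ∑ i ∈ Finset.range k, (T.getD i []).length

@[simp]
theorem topSize_zero (T : List (List A)) : topSize 0 T = 0 := rfl

@[simp]
theorem topSize_nil (k : ℕ) : topSize k ([] : List (List A)) = 0 := by simp [topSize]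

theorem topSize_succ_cons (k : ℕ) (r : List A) (T : List (List A)) :
    topSize (k + 1) (r :: T) = r.length + topSize k T := by
  simp [topSize, Finset.sum_range_succ', add_comm]

/-- The row word of a tableau with each letter labelled by its column. -/
def labelledRowWord (T : List (List A)) : List (A × ℕ) := rowWord (T.map List.zipIdx)

theorem labelledRowWord_cons (r : List A) (T : List (List A)) :
    labelledRowWord (r :: T) = labelledRowWord T ++ r.zipIdx :=
  rowWord_cons _ _

theorem map_fst_labelledRowWord (T : List (List A)) :
    (labelledRowWord T).map Prod.fst = rowWord T := by
  induction T with
  | nil => rfl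
  | cons r T ih => simp [labelledRowWord_cons, rowWord_cons, ih, List.zipIdx_map_fst]

theorem countP_zipIdx (r : List A) (c : ℕ) :
    (r.zipIdx.countP fun p => p.2 = c) = if c < r.length then 1 else 0 := by
  have hsnd : (r.zipIdx.countP fun p => p.2 = c) = (r.zipIdx.map Prod.snd).count c := by
    rw [List.count, List.countP_map]
    rfl
  have hnodup : (List.range' 0 r.length).Nodup := List.nodup_range'
  rw [hsnd, List.zipIdx_map_snd, hnodup.count]
  simp

variable [LinearOrder A]

/-- `Chains w σ N` says that weakly increasing sequences with the final letters `σ` can be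
continued by disjoint subsequences of the word `w` of total length `N`. These numbers are the
Greene invariants of `w`, relative to given starting letters. -/
inductive Chains : List A → Multiset A → ℕ → Prop
  | nil (σ) : Chains [] σ 0
  | skip {x v σ N} (h : Chains v σ N) : Chains (x :: v) σ N
  | take {x v a τ N} (hax : a ≤ x) (h : Chains v (x ::ₘ τ) N) : Chains (x :: v) (a ::ₘ τ) (N + 1)

theorem chains_cons_iff {x : A} {v : List A} {σ : Multiset A} {N : ℕ} :
    Chains (x :: v) σ N ↔
      Chains v σ N ∨ ∃ a τ M, σ = a ::ₘ τ ∧ N = M + 1 ∧ a ≤ x ∧ Chains v (x ::ₘ τ) M := by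
  refine ⟨fun h => ?_, ?_⟩
  · cases h with
    | skip h => exact .inl h
    | take hax h => exact .inr ⟨_, _, _, rfl, rfl, hax, h⟩
  · rintro (h | ⟨a, τ, M, rfl, rfl, hax, h⟩)
    exacts [.skip h, .take hax h]

theorem Chains.take_second {x a b : A} {v : List A} {τ : Multiset A} {N : ℕ} (hax : a ≤ x)
    (h : Chains v (x ::ₘ b ::ₘ τ) N) : Chains (x :: v) (b ::ₘ a ::ₘ τ) (N + 1) := by
  rw [Multiset.cons_swap]
  exact .take hax h

theorem Chains.anti {v : List A} {a b : A} {τ : Multiset A} {N : ℕ} (hab : a ≤ b)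
    (h : Chains v (b ::ₘ τ) N) : Chains v (a ::ₘ τ) N := by
  induction v generalizing a b τ N with
  | nil => cases h; exact .nil _
  | cons x v ih =>
    rcases chains_cons_iff.1 h with h | ⟨e, ρ, M, he, rfl, hex, h⟩
    · exact .skip (ih hab h)
    · rcases Multiset.cons_eq_cons.1 he with ⟨rfl, rfl⟩ | ⟨-, ρ, rfl, rfl⟩
      · exact .take (hab.trans hex) h
      · rw [Multiset.cons_swap] at h
        exact .take_second hex (Multiset.cons_swap a x ρ ▸ ih hab h)

theorem Chains.cons_right {v : List A} {σ : Multiset A} {N : ℕ} (b : A) (h : Chains v σ N) :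
    Chains v (b ::ₘ σ) N := by
  induction h with
  | nil => exact .nil _
  | skip _ ih => exact .skip ih
  | take hax _ ih => exact .take_second hax (Multiset.cons_swap b _ _ ▸ ih)

theorem Chains.append_congr {u v : List A} (h : ∀ σ N, Chains u σ N ↔ Chains v σ N) (p : List A)
    (σ : Multiset A) (N : ℕ) : Chains (p ++ u) σ N ↔ Chains (p ++ v) σ N := by
  induction p generalizing σ N with
  | nil => exact h σ N
  | cons x p ih => simp only [List.cons_append, chains_cons_iff, ih]

theorem Chains.swap {x z : A} {q : List A} {σ : Multiset A} {N : ℕ} (hxz : x < z)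
    (h : Chains (z :: x :: q) σ N) : Chains (x :: z :: q) σ N := by
  rcases chains_cons_iff.1 h with h | ⟨b, τ, M, rfl, rfl, hbz, h⟩
  · rcases chains_cons_iff.1 h with h | ⟨a, τ, M, rfl, rfl, hax, h⟩
    exacts [.skip (.skip h), .take hax (.skip h)]
  · rcases chains_cons_iff.1 h with h | ⟨a, ρ, M, ha, rfl, hax, h⟩
    · exact .skip (.take hbz h)
    · rcases Multiset.cons_eq_cons.1 ha with ⟨rfl, rfl⟩ | ⟨-, ρ, rfl, rfl⟩
      · exact absurd hxz hax.not_gt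
      · exact .take_second hax (.take_second hbz (Multiset.cons_swap x z ρ ▸ h))

/-- The exceptional case is that a single sequence takes both letters. -/
theorem Chains.swap_or {x z : A} {q : List A} {σ : Multiset A} {N : ℕ}
    (h : Chains (x :: z :: q) σ N) : Chains (z :: x :: q) σ N ∨
      ∃ a τ M, σ = a ::ₘ τ ∧ N = M + 2 ∧ a ≤ x ∧ Chains q (z ::ₘ τ) M := by
  rcases chains_cons_iff.1 h with h | ⟨a, τ, M, rfl, rfl, hax, h⟩
  · rcases chains_cons_iff.1 h with h | ⟨b, τ, M, rfl, rfl, hbz, h⟩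
    exacts [.inl (.skip (.skip h)), .inl (.take hbz (.skip h))]
  · rcases chains_cons_iff.1 h with h | ⟨b, ρ, M, hb, rfl, hbz, h⟩
    · exact .inl (.skip (.take hax h))
    · rcases Multiset.cons_eq_cons.1 hb with ⟨rfl, rfl⟩ | ⟨-, ρ, rfl, rfl⟩
      · exact .inr ⟨a, τ, M, rfl, rfl, hax, h⟩
      · exact .inl (.take_second hbz (.take_second hax (Multiset.cons_swap z x ρ ▸ h)))

theorem chains_swap_after {x y z : A} (q : List A) (hxy : x < y) (hyz : y ≤ z) (σ : Multiset A)
    (N : ℕ) : Chains (y :: z :: x :: q) σ N ↔ Chains (y :: x :: z :: q) σ N := by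
  have hxz := hxy.trans_le hyz
  refine ⟨fun h => ?_, fun h => ?_⟩
  · rcases chains_cons_iff.1 h with h | ⟨e, τ, M, rfl, rfl, hey, h⟩
    exacts [.skip (h.swap hxz), .take hey (h.swap hxz)]
  · rcases chains_cons_iff.1 h with h | ⟨e, ρ, M, rfl, rfl, hey, h⟩
    · rcases h.swap_or with h | ⟨a, τ, M, rfl, rfl, hax, h⟩
      · exact .skip h
      · exact .take (hax.trans hxy.le) (.take hyz (.skip h))
    · rcases h.swap_or with h | ⟨a, τ, M, ha, rfl, hax, h⟩
      · exact .take hey h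
      · rcases Multiset.cons_eq_cons.1 ha with ⟨rfl, rfl⟩ | ⟨-, ρ, rfl, rfl⟩
        · exact absurd hxy hax.not_gt
        · refine .take hey (.take hyz (.take_second hax ?_))
          rw [Multiset.cons_swap] at h
          exact h.anti hxy.le

theorem chains_swap_before {x y z : A} (q : List A) (hxy : x ≤ y) (hyz : y < z) (σ : Multiset A)
    (N : ℕ) : Chains (x :: z :: y :: q) σ N ↔ Chains (z :: x :: y :: q) σ N := by
  refine ⟨fun h => ?_, fun h => h.swap (hxy.trans_lt hyz)⟩
  rcases h.swap_or with h | ⟨a, τ, M, rfl, rfl, hax, h⟩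
  · exact h
  · rcases chains_cons_iff.1 h with h | ⟨e, ρ, M, he, rfl, hey, h⟩
    · exact .skip (.take hax (.take hxy (h.anti hyz.le)))
    · rcases Multiset.cons_eq_cons.1 he with ⟨rfl, rfl⟩ | ⟨-, ρ, rfl, rfl⟩
      · exact absurd hyz hey.not_gt
      · exact .take_second (hey.trans hyz.le) (.take_second hax (.take hxy
          (Multiset.cons_swap y z ρ ▸ h)))

theorem Knuth.chains_iff {u v : List A} (h : Knuth u v) (σ : Multiset A) (N : ℕ) :
    Chains u σ N ↔ Chains v σ N := by
  induction h generalizing σ N with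
  | refl u => rfl
  | symm _ ih => exact (ih σ N).symm
  | trans _ _ ih ih' => exact (ih σ N).trans (ih' σ N)
  | swap_after p q hxy hyz => exact Chains.append_congr (chains_swap_after q hxy hyz) p σ N
  | swap_before p q hxy hyz => exact Chains.append_congr (chains_swap_before q hxy hyz) p σ N

theorem Chains.skip_append {v : List A} {σ : Multiset A} {N : ℕ} (h : Chains v σ N)
    (r : List A) : Chains (r ++ v) σ N := by
  induction r with
  | nil => exact h
  | cons x r ih => exact .skip ih

theorem Chains.take_append {v r : List A} {a : A} {τ : Multiset A} {N : ℕ} (h : Chains v τ N)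
    (har : (a :: r).Pairwise (· ≤ ·)) : Chains (r ++ v) (a ::ₘ τ) (N + r.length) := by
  induction r generalizing a with
  | nil => exact h.cons_right a
  | cons x r ih =>
    exact .take (List.rel_of_pairwise_cons har List.mem_cons_self) (ih har.of_cons)

/-- The rows themselves are the increasing sequences: the `i`-th starting letter of `l` is
continued by the whole `i`-th row. -/
theorem chains_rowWord_append {T : List (List A)} (hT : ∀ r ∈ T, r.Pairwise (· ≤ ·)) {l : List A}
    (hl : ∀ i, ∀ a ∈ l[i]?, ∀ b ∈ T.getD i [], a ≤ b) {v : List A} {τ : Multiset A} {N : ℕ}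
    (h : Chains v τ N) : Chains (rowWord T ++ v) (l + τ) (N + topSize l.length T) := by
  induction T generalizing l v τ N with
  | nil =>
    induction l with
    | nil => simpa [rowWord] using h
    | cons a l ih =>
      rw [← Multiset.cons_coe, Multiset.cons_add]
      simpa using (ih (by simp)).cons_right a
  | cons r T ih =>
    obtain ⟨hr, hT⟩ := List.forall_mem_cons.1 hT
    rw [rowWord_cons, List.append_assoc]
    cases l with
    | nil => simpa using (h.skip_append r).skip_append (rowWord T)
    | cons a l =>
      have har : (a :: r).Pairwise (· ≤ ·) :=
        List.pairwise_cons.2 ⟨by simpa using hl 0 a, hr⟩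
      have htail := ih hT (l := l) (fun i => by simpa using hl (i + 1)) (h.take_append har)
      rw [List.length_cons, topSize_succ_cons, ← add_assoc, ← Multiset.cons_coe,
        Multiset.cons_add, ← Multiset.add_cons]
      exact htail

theorem countP_le_countP_of_imp {B : Type*} {p q : B → Prop} [DecidablePred p] [DecidablePred q]
    {σ : Multiset B} (h : ∀ b, p b → q b) : σ.countP p ≤ σ.countP q := by
  simp only [Multiset.countP_eq_card_filter]
  exact Multiset.card_le_card (Multiset.monotone_filter_right σ h)

section LabelBound

variable {C : Type*} [DecidableEq C]

open Classical in
/-- A bound on the number of letters with the label `c` in the labelled word `v` that increasing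
sequences with the final letters `σ` can take if each of them takes at most one: the number of these
letters, and also the number of the sequences that one of them can continue. -/
noncomputable def labelBound (v : List (A × C)) (σ : Multiset A) (c : C) : ℕ :=
  min (v.countP fun p => p.2 = c) (σ.countP fun a => ∃ p ∈ v, p.2 = c ∧ a ≤ p.1)

theorem labelBound_le_cons (p : A × C) (v : List (A × C)) (σ : Multiset A) (c : C) :
    labelBound v σ c ≤ labelBound (p :: v) σ c := by
  classical
  refine min_le_min ?_ ?_
  · rw [List.countP_cons]
    exact Nat.le_add_right _ _
  · exact countP_le_countP_of_imp fun a ⟨q, hq, hqa⟩ => ⟨q, List.mem_cons_of_mem _ hq, hqa⟩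

theorem labelBound_cons_le {v : List (A × C)} {a b : A} (hab : a ≤ b) (τ : Multiset A)
    (c : C) : labelBound v (b ::ₘ τ) c ≤ labelBound v (a ::ₘ τ) c := by
  classical
  refine min_le_min le_rfl ?_
  rw [Multiset.countP_cons, Multiset.countP_cons]
  refine Nat.add_le_add_left ?_ _
  split_ifs with hb ha
  · rfl
  · obtain ⟨q, hq, hqc, hbq⟩ := hb
    exact absurd ⟨q, hq, hqc, hab.trans hbq⟩ ha
  · exact zero_le_one
  · rfl

theorem labelBound_lt_cons {p : A × C} {v : List (A × C)}
    (hv : ∀ q ∈ v, p.2 = q.2 → q.1 < p.1) {a : A} (hap : a ≤ p.1) (τ : Multiset A) :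
    labelBound v (p.1 ::ₘ τ) p.2 < labelBound (p :: v) (a ::ₘ τ) p.2 := by
  classical
  have hp : ¬ ∃ q ∈ v, q.2 = p.2 ∧ p.1 ≤ q.1 := by
    rintro ⟨q, hq, hqp, hpq⟩
    exact (hv q hq hqp.symm).not_ge hpq
  have ha : ∃ q ∈ p :: v, q.2 = p.2 ∧ a ≤ q.1 := ⟨p, List.mem_cons_self, rfl, hap⟩
  have hτ : τ.countP (fun b => ∃ q ∈ v, q.2 = p.2 ∧ b ≤ q.1) ≤
      τ.countP fun b => ∃ q ∈ p :: v, q.2 = p.2 ∧ b ≤ q.1 :=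
    countP_le_countP_of_imp fun b ⟨q, hq, hqb⟩ => ⟨q, List.mem_cons_of_mem _ hq, hqb⟩
  rw [labelBound, labelBound, Multiset.countP_cons, Multiset.countP_cons, if_neg hp, if_pos ha,
    List.countP_cons_of_pos (by simp)]
  omega

theorem Chains.le_sum_labelBound {S : Finset C} {v : List (A × C)}
    (hv : v.Pairwise fun p q => p.2 = q.2 → q.1 < p.1) (hS : ∀ p ∈ v, p.2 ∈ S) {σ : Multiset A}
    {N : ℕ} (h : Chains (v.map Prod.fst) σ N) : N ≤ ∑ c ∈ S, labelBound v σ c := by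
  induction v generalizing σ N with
  | nil => cases h; exact Nat.zero_le _
  | cons p v ih =>
    obtain ⟨hpv, hv⟩ := List.pairwise_cons.1 hv
    obtain ⟨hpS, hS⟩ := List.forall_mem_cons.1 hS
    rcases chains_cons_iff.1 h with h | ⟨a, τ, M, rfl, rfl, hap, h⟩
    · exact (ih hv hS h).trans (Finset.sum_le_sum fun c _ => labelBound_le_cons p v σ c)
    · refine (ih hv hS h).trans_lt (Finset.sum_lt_sum (fun c _ => ?_) ⟨p.2, hpS, ?_⟩)
      · exact (labelBound_cons_le hap τ c).trans (labelBound_le_cons p v _ c)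
      · exact labelBound_lt_cons hpv hap τ

end LabelBound

theorem ColStrict.exists_getElem? {r s : List A} (h : ColStrict r s) {j : ℕ} {b : A}
    (hb : s[j]? = some b) : ∃ a, r[j]? = some a ∧ a < b := by
  induction s generalizing r j with
  | nil => simp at hb
  | cons c s ih =>
    cases r with
    | nil => exact h.elim
    | cons a r =>
      cases j with
      | zero => exact ⟨a, rfl, Option.some_inj.1 hb ▸ h.1⟩
      | succ j => exact ih h.2 hb

theorem IsTableau.tail {r : List A} {T : List (List A)} (h : IsTableau (r :: T)) : IsTableau T :=
  ⟨(List.forall_mem_cons.1 h.sorted).2, h.isChain.tail⟩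

theorem IsTableau.exists_getElem?_head {r : List A} {T : List (List A)} (h : IsTableau (r :: T))
    {b : A} {j : ℕ} (hb : (b, j) ∈ labelledRowWord T) : ∃ a, r[j]? = some a ∧ a < b := by
  induction T generalizing r with
  | nil => simp [labelledRowWord, rowWord] at hb
  | cons s T ih =>
    have hrs : ColStrict r s := (List.isChain_cons_cons.1 h.isChain).1
    rw [labelledRowWord_cons, List.mem_append] at hb
    rcases hb with hb | hb
    · obtain ⟨c, hc, hcb⟩ := ih h.tail hb
      obtain ⟨a, ha, hac⟩ := hrs.exists_getElem? hc
      exact ⟨a, ha, hac.trans hcb⟩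
    · exact hrs.exists_getElem? (List.mem_zipIdx_iff_getElem?.1 hb)

theorem IsTableau.pairwise_labelledRowWord {T : List (List A)} (h : IsTableau T) :
    (labelledRowWord T).Pairwise fun p q => p.2 = q.2 → q.1 < p.1 := by
  induction T with
  | nil => exact List.Pairwise.nil
  | cons r T ih =>
    rw [labelledRowWord_cons, List.pairwise_append]
    refine ⟨ih h.tail, ?_, ?_⟩
    · have hne : (r.zipIdx.map Prod.snd).Pairwise (· ≠ ·) := by
        rw [List.zipIdx_map_snd]
        exact List.nodup_range'
      exact (List.pairwise_map.1 hne).imp fun hne heq => absurd heq hne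
    · rintro ⟨b, j⟩ hb ⟨a, j'⟩ ha rfl
      obtain ⟨a', ha', hab⟩ := h.exists_getElem?_head hb
      rw [List.mem_zipIdx_iff_getElem?] at ha
      simp_all

theorem IsTableau.sum_min_countP_labelledRowWord {T : List (List A)} (h : IsTableau T) {C : ℕ}
    (hC : ∀ r ∈ T, r.length ≤ C) (k : ℕ) :
    ∑ c ∈ Finset.range C, min ((labelledRowWord T).countP fun p => p.2 = c) k = topSize k T := by
  induction T generalizing k with
  | nil => simp [labelledRowWord, rowWord]
  | cons r T ih =>
    obtain ⟨hr, hC⟩ := List.forall_mem_cons.1 hC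
    cases k with
    | zero => simp
    | succ k =>
      have hcol (c : ℕ) : min ((labelledRowWord (r :: T)).countP fun p => p.2 = c) (k + 1) =
          (if c < r.length then 1 else 0) +
            min ((labelledRowWord T).countP fun p => p.2 = c) k := by
        rw [labelledRowWord_cons, List.countP_append, countP_zipIdx]
        split_ifs with hc
        · omega
        · have hzero : ((labelledRowWord T).countP fun p => p.2 = c) = 0 := by
            rw [List.countP_eq_zero]
            rintro ⟨b, j⟩ hb
            obtain ⟨a, ha, -⟩ := h.exists_getElem?_head hb
            have hj := (List.getElem?_eq_some_iff.1 ha).1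
            simp only [decide_eq_true_eq]
            omega
          omega
      have hrow : ∑ c ∈ Finset.range C, (if c < r.length then 1 else 0) = r.length := by
        rw [← Finset.card_filter, show (Finset.range C).filter (· < r.length) =
          Finset.range r.length by ext c; simp; omega, Finset.card_range]
      simp only [hcol, Finset.sum_add_distrib, hrow, ih h.tail hC, topSize_succ_cons]

theorem IsTableau.le_topSize_of_chains {T : List (List A)} (h : IsTableau T) {σ : Multiset A}
    {N : ℕ} (hN : Chains (rowWord T) σ N) : N ≤ topSize (Multiset.card σ) T := by
  classical
  have hlength : ∀ r ∈ T, r.length ≤ (T.map List.length).sum := fun r hr =>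
    List.le_sum_of_mem (List.mem_map_of_mem hr)
  have hlabel : ∀ p ∈ labelledRowWord T, p.2 ∈ Finset.range (T.map List.length).sum := by
    rintro ⟨b, j⟩ hb
    simp only [labelledRowWord, rowWord, List.mem_flatten, List.mem_reverse, List.mem_map] at hb
    obtain ⟨_, ⟨r, hr, rfl⟩, hb⟩ := hb
    rw [List.mem_zipIdx_iff_getElem?] at hb
    exact Finset.mem_range.2 ((List.getElem?_eq_some_iff.1 hb).1.trans_le (hlength r hr))
  rw [← map_fst_labelledRowWord] at hN
  rw [← h.sum_min_countP_labelledRowWord hlength]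
  refine (hN.le_sum_labelBound h.pairwise_labelledRowWord hlabel).trans
    (Finset.sum_le_sum fun c _ => ?_)
  exact min_le_min le_rfl (Multiset.countP_le_card _ σ)

theorem le_topSize_insertionTableau {w : List A} {σ : Multiset A} {N : ℕ} (h : Chains w σ N) :
    N ≤ topSize (Multiset.card σ) (insertionTableau w) :=
  (isTableau_insertionTableau w).le_topSize_of_chains
    (((knuth_insertionTableau w).chains_iff σ N).1 h)

theorem chains_topSize_insertionTableau {w l : List A}
    (hl : ∀ i, ∀ a ∈ l[i]?, ∀ b ∈ (insertionTableau w).getD i [], a ≤ b) :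
    Chains w l (topSize l.length (insertionTableau w)) := by
  refine ((knuth_insertionTableau w).chains_iff _ _).2 ?_
  simpa using chains_rowWord_append (isTableau_insertionTableau w).sorted hl (Chains.nil 0)

theorem topSize_insertionTableau_le_cons {a : A} (ha : IsBot a) (k : ℕ) (x : A) (w : List A) :
    topSize k (insertionTableau w) ≤ topSize k (insertionTableau (x :: w)) := by
  have h : Chains w _ _ := chains_topSize_insertionTableau (w := w) (l := .replicate k a)
    fun i b hb => by
      obtain rfl := (List.mem_replicate.1 (List.mem_of_getElem? hb)).2
      exact fun c _ => ha c
  simpa using le_topSize_insertionTableau (h.skip (x := x))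

/-- The letter `x` in front can start the sequence that runs through row `m`. -/
theorem topSize_insertionTableau_lt_cons {a : A} (ha : IsBot a) {k m : ℕ} (hm : m < k) {x : A}
    {w : List A} (hx : ∀ b ∈ (insertionTableau w).getD m [], x ≤ b) :
    topSize k (insertionTableau w) < topSize k (insertionTableau (x :: w)) := by
  obtain ⟨n, rfl⟩ : ∃ n, k = m + 1 + n := Nat.exists_eq_add_of_le hm
  have h : Chains w _ _ := chains_topSize_insertionTableau (w := w)
    (l := .replicate m a ++ x :: .replicate n a) fun i b hb => by
      have ha : ∀ b, a ≤ b := ha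
      grind
  rw [Multiset.coe_eq_coe.2 List.perm_middle, ← Multiset.cons_coe] at h
  have h' := le_topSize_insertionTableau (Chains.take (ha x) h)
  rw [Multiset.card_cons, Multiset.coe_card] at h'
  simp only [List.length_append, List.length_cons, List.length_replicate] at h'
  rwa [← add_assoc, add_right_comm] at h'

end Greene

/-! ### Tableaux as queues in tandem -/

section Queues

variable {d : ℕ}

/-- The queue at `(i, j)`, `i < j`, holds the letters `j` of row `i`. It is passed by a token, which
carries the letter that travels down the tableau: a token `j` joins the queue and becomes the idle
token `i`; an idle token `i` releases a letter `j`, if there is one. -/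
def cellMove (i j : Fin d) (p : (Fin d × Fin d → ℕ) × Fin d) : (Fin d × Fin d → ℕ) × Fin d :=
  if p.2 = j then (Function.update p.1 (i, j) (p.1 (i, j) + 1), i)
  else if p.2 = i ∧ 0 < p.1 (i, j) then (Function.update p.1 (i, j) (p.1 (i, j) - 1), j)
  else p

/-- The passage of a token through the queues `(i, j)`, for `j` in a list. -/
def cellsPass (i : Fin d) (l : List (Fin d)) (p : (Fin d × Fin d → ℕ) × Fin d) :
    (Fin d × Fin d → ℕ) × Fin d :=
  l.foldl (fun p j => cellMove i j p) p

/-- The passage of a token through the queues of row `i`. -/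
def rowPass (i : Fin d) (p : (Fin d × Fin d → ℕ) × Fin d) : (Fin d × Fin d → ℕ) × Fin d :=
  cellsPass i ((List.finRange d).filter (i < ·)) p

/-- The passage of a token through the rows in a list. -/
def rowsPass (l : List (Fin d)) (p : (Fin d × Fin d → ℕ) × Fin d) :
    (Fin d × Fin d → ℕ) × Fin d :=
  l.foldl (fun p i => rowPass i p) p

/-- The state of the queues after a token has passed through all the rows. -/
def queueInsert (s : Fin d × Fin d → ℕ) (x : Fin d) : Fin d × Fin d → ℕ :=
  (rowsPass (List.finRange d) (s, x)).1

theorem cellMove_involutive {i j : Fin d} (hij : i ≠ j) : Function.Involutive (cellMove i j) := by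
  rintro ⟨s, t⟩
  by_cases hj : t = j
  · subst hj
    simp [cellMove, hij]
  · by_cases hi : t = i ∧ 0 < s (i, j)
    · obtain ⟨rfl, hpos⟩ := hi
      simp [cellMove, hij, hpos, Nat.sub_add_cancel (Nat.succ_le_of_lt hpos)]
    · simp only [cellMove, hj, hi, if_false]

theorem cellMove_of_ne {i j t : Fin d} (s : Fin d × Fin d → ℕ) (hi : t ≠ i) (hj : t ≠ j) :
    cellMove i j (s, t) = (s, t) := by
  simp [cellMove, hi, hj]

theorem cellsPass_of_notMem {i t : Fin d} {l : List (Fin d)} (s : Fin d × Fin d → ℕ) (hi : t ≠ i)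
    (hl : t ∉ l) : cellsPass i l (s, t) = (s, t) := by
  induction l with
  | nil => rfl
  | cons a l ih =>
    rw [List.mem_cons, not_or] at hl
    rw [cellsPass, List.foldl_cons, cellMove_of_ne s hi hl.1]
    exact ih hl.2

theorem cellsPass_apply_of_ne {i m : Fin d} (hm : m ≠ i) (j : Fin d) (l : List (Fin d))
    (p : (Fin d × Fin d → ℕ) × Fin d) : (cellsPass i l p).1 (m, j) = p.1 (m, j) := by
  induction l generalizing p with
  | nil => rfl
  | cons a l ih =>
    refine (ih _).trans ?_
    simp only [cellMove]
    split_ifs <;> simp [hm]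

theorem rowPass_of_lt {i t : Fin d} (h : t < i) (s : Fin d × Fin d → ℕ) :
    rowPass i (s, t) = (s, t) :=
  cellsPass_of_notMem s h.ne (by simpa using h.le)

theorem rowsPass_of_lt {t : Fin d} {l : List (Fin d)} (hl : ∀ i ∈ l, t < i)
    (s : Fin d × Fin d → ℕ) : rowsPass l (s, t) = (s, t) := by
  induction l with
  | nil => rfl
  | cons a l ih =>
    rw [List.forall_mem_cons] at hl
    rw [rowsPass, List.foldl_cons, rowPass_of_lt hl.1]
    exact ih hl.2

theorem rowsPass_apply_of_notMem {m : Fin d} {l : List (Fin d)} (hm : m ∉ l) (j : Fin d)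
    (p : (Fin d × Fin d → ℕ) × Fin d) : (rowsPass l p).1 (m, j) = p.1 (m, j) := by
  induction l generalizing p with
  | nil => rfl
  | cons a l ih =>
    rw [List.mem_cons, not_or] at hm
    exact (ih hm.2 _).trans (cellsPass_apply_of_ne hm.1 j _ p)

theorem cellsPass_conserves {i q : Fin d} (hq : q ≠ i) (l : List (Fin d))
    (p : (Fin d × Fin d → ℕ) × Fin d) :
    (cellsPass i l p).1 (i, q) + (if (cellsPass i l p).2 = q then 1 else 0) =
      p.1 (i, q) + (if p.2 = q then 1 else 0) := by
  induction l generalizing p with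
  | nil => rfl
  | cons a l ih =>
    refine (ih _).trans ?_
    simp only [cellMove]
    split_ifs <;> grind

/-- A token that has joined its queue is idle, so it is always the smallest available letter beyond
the incoming one that is released. -/
theorem cellsPass_snd {i y : Fin d} {l : List (Fin d)} (hl : l.Pairwise (· < ·))
    (hi : ∀ j ∈ l, i < j) (hy : y = i ∨ y ∈ l) (s : Fin d × Fin d → ℕ) :
    (cellsPass i l (s, y)).2 = (l.find? fun j => y < j ∧ 0 < s (i, j)).getD i := by
  induction l generalizing y s with
  | nil => simpa [cellsPass] using hy
  | cons a l ih =>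
    rw [List.pairwise_cons] at hl
    rw [List.forall_mem_cons] at hi
    rw [cellsPass, List.foldl_cons, ← cellsPass]
    by_cases hya : y = a
    · subst hya
      have hmove : cellMove i y (s, y) = (Function.update s (i, y) (s (i, y) + 1), i) := by
        simp [cellMove]
      rw [hmove, ih hl.2 hi.2 (.inl rfl), List.find?_cons_of_neg (by simp)]
      congr 1
      refine List.find?_congr fun j hj => ?_
      simp [hi.2 j hj, hl.1 j hj, (hl.1 j hj).ne']
    have hyl : y = i ∨ y ∈ l := by simpa [hya] using hy
    by_cases hrel : y = i ∧ 0 < s (i, a)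
    · obtain ⟨rfl, hpos⟩ := hrel
      have hmove : cellMove y a (s, y) = (Function.update s (y, a) (s (y, a) - 1), a) := by
        simp [cellMove, hya, hpos]
      rw [hmove, cellsPass_of_notMem _ hi.1.ne' fun h => (hl.1 a h).false,
        List.find?_cons_of_pos (by simp [hi.1, hpos])]
      rfl
    · have hmove : cellMove i a (s, y) = (s, y) := by simp only [cellMove, hya, hrel, if_false]
      rw [hmove, ih hl.2 hi.2 hyl s, List.find?_cons_of_neg]
      rcases hyl with rfl | hyl
      · simp_all
      · simp [(hl.1 y hyl).le]

theorem rowPass_snd {i y : Fin d} (hy : i ≤ y) (s : Fin d × Fin d → ℕ) :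
    (rowPass i (s, y)).2 = ((List.finRange d).find? fun j => y < j ∧ 0 < s (i, j)).getD i := by
  rw [rowPass, cellsPass_snd ((List.pairwise_lt_finRange d).filter _) (by simp)
    (by simpa [eq_comm] using hy.eq_or_lt), List.find?_filter]
  congr 2
  ext j
  simpa using fun hj _ => hy.trans_lt hj

theorem find?_eq_some_iff_isLeast {A : Type*} [LinearOrder A] {r : List A}
    (hr : r.Pairwise (· ≤ ·)) (p : A → Bool) (b : A) :
    r.find? p = some b ↔ IsLeast {j | j ∈ r ∧ p j} b := by
  induction r with
  | nil => simp [IsLeast]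
  | cons a r ih =>
    rw [List.pairwise_cons] at hr
    by_cases ha : p a
    · have hleast : IsLeast {j | j ∈ a :: r ∧ p j} a :=
        ⟨⟨List.mem_cons_self, ha⟩, fun j hj => by
          rcases List.mem_cons.1 hj.1 with rfl | hjr
          exacts [le_rfl, hr.1 j hjr]⟩
      rw [List.find?_cons_of_pos ha, Option.some_inj]
      exact ⟨fun h => h ▸ hleast, hleast.unique⟩
    · have hset : {j | j ∈ a :: r ∧ p j} = {j | j ∈ r ∧ p j} := by
        ext j
        have hja : p j → j ≠ a := by rintro hj rfl; exact ha hj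
        simp only [Set.mem_ofPred_eq, List.mem_cons]
        tauto
      rw [List.find?_cons_of_neg ha, hset]
      exact ih hr.2

theorem rowPass_rowInsert {i x : Fin d} (hx : i ≤ x) {r : List (Fin d)} (hr : r.Pairwise (· ≤ ·))
    {s : Fin d × Fin d → ℕ} (hs : ∀ j, i < j → s (i, j) = r.count j) :
    (rowPass i (s, x)).2 = (rowInsert x r).2.getD i ∧
      ∀ j, i < j → (rowPass i (s, x)).1 (i, j) = (rowInsert x r).1.count j := by
  have htoken : (rowPass i (s, x)).2 = (rowInsert x r).2.getD i := by
    rw [rowPass_snd hx, rowInsert_snd]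
    congr 1
    ext b
    rw [find?_eq_some_iff_isLeast ((List.pairwise_lt_finRange d).imp le_of_lt),
      find?_eq_some_iff_isLeast hr]
    congr! 3 with j
    have hpos : x < j → (0 < s (i, j) ↔ j ∈ r) := fun hj => by
      rw [hs j (hx.trans_lt hj), List.count_pos_iff]
    simp
    tauto
  refine ⟨htoken, fun j hj => ?_⟩
  have hqueue := cellsPass_conserves hj.ne' ((List.finRange d).filter (i < ·)) (s, x)
  have hrow := (rowInsert_perm x r).count_eq j
  rw [← rowPass, htoken] at hqueue
  rw [List.count_append, List.count_cons] at hrow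
  cases hb : (rowInsert x r).2 <;>
    grind [List.count_singleton, Option.toList_none, Option.toList_some]

/-- The state `s` records, for the rows in a list, how many letters `j` the row `i < j` of a tableau
contains; the `n`-th row of the tableau carries the `n`-th label of the list. -/
def Records (l : List (Fin d)) (s : Fin d × Fin d → ℕ) (T : List (List (Fin d))) : Prop :=
  ∀ (n : ℕ) (i j : Fin d), l[n]? = some i → i < j → s (i, j) = (T.getD n []).count j

theorem records_cons_iff {i : Fin d} {l : List (Fin d)} {s : Fin d × Fin d → ℕ}
    {T : List (List (Fin d))} : Records (i :: l) s T ↔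
      (∀ j, i < j → s (i, j) = (T.headD []).count j) ∧ Records l s T.tail := by
  have hhead : T.getD 0 [] = T.headD [] := by cases T <;> rfl
  have htail (n : ℕ) : T.getD (n + 1) [] = T.tail.getD n [] := by cases T <;> rfl
  refine ⟨fun h => ⟨fun j hj => hhead ▸ h 0 i j rfl hj, fun n a j ha hj =>
    htail n ▸ h (n + 1) a j ha hj⟩, fun h n a j ha hj => ?_⟩
  cases n with
  | zero =>
    obtain rfl : i = a := by simpa using ha
    exact hhead ▸ h.1 j hj
  | succ n => exact htail n ▸ h.2 n a j ha hj

theorem Records.congr {l : List (Fin d)} {s s' : Fin d × Fin d → ℕ} {T : List (List (Fin d))}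
    (h : Records l s T) (hs : ∀ i ∈ l, ∀ j, s' (i, j) = s (i, j)) : Records l s' T :=
  fun n i j hi hj => (hs i (List.mem_of_getElem? hi) j).trans (h n i j hi hj)

theorem Records.rowsPass_tableauInsert {l : List (Fin d)} (hl : l.Pairwise (· < ·))
    (hup : ∀ i ∈ l, ∀ j, i ≤ j → j ∈ l) {x : Fin d} (hx : x ∈ l) {T : List (List (Fin d))}
    (hT : ∀ r ∈ T, r.Pairwise (· ≤ ·)) {s : Fin d × Fin d → ℕ} (h : Records l s T) :
    Records l (rowsPass l (s, x)).1 (tableauInsert T x) := by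
  induction l generalizing x T s with
  | nil => simp at hx
  | cons i l ih =>
    rw [List.pairwise_cons] at hl
    rw [records_cons_iff] at h
    have hil : i ∉ l := fun hi => (hl.1 i hi).false
    have hix : i ≤ x := by
      rcases List.mem_cons.1 hx with rfl | hx
      exacts [le_rfl, (hl.1 x hx).le]
    have hsorted : (T.headD []).Pairwise (· ≤ ·) := by
      cases T with
      | nil => exact List.Pairwise.nil
      | cons r T => exact hT r List.mem_cons_self
    obtain ⟨htoken, hcount⟩ := rowPass_rowInsert hix hsorted h.1
    have hrest : Records l (rowPass i (s, x)).1 T.tail :=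
      h.2.congr fun m hm j => cellsPass_apply_of_ne (hl.1 m hm).ne' j _ _
    have hpass : rowsPass (i :: l) (s, x) =
        rowsPass l ((rowPass i (s, x)).1, (rowInsert x (T.headD [])).2.getD i) := by
      rw [← htoken]; rfl
    rw [tableauInsert_eq, records_cons_iff, hpass]
    refine ⟨fun j hj => (rowsPass_apply_of_notMem hil j _).trans (hcount j hj), ?_⟩
    cases hb : (rowInsert x (T.headD [])).2 with
    | none =>
      rw [Option.getD_none, rowsPass_of_lt hl.1]
      exact hrest
    | some y =>
      have hmem {j : Fin d} (hj : i < j) : j ∈ l :=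
        (List.mem_cons.1 (hup i List.mem_cons_self j hj.le)).resolve_left hj.ne'
      exact ih hl.2 (fun a ha j haj => hmem ((hl.1 a ha).trans_le haj))
        (hmem (hix.trans_lt (lt_of_rowInsert_snd_eq_some hb)))
        (fun r hr => hT r (List.mem_of_mem_tail hr)) hrest

theorem foldl_queueInsert_eq_count (w : List (Fin d)) {i j : Fin d} (hij : i < j) :
    w.foldl queueInsert 0 (i, j) = ((insertionTableau w).getD i []).count j := by
  have hrec : Records (List.finRange d) (w.foldl queueInsert 0) (insertionTableau w) := by
    induction w using List.reverseRecOn with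
    | nil => simp [Records, insertionTableau]
    | append_singleton w x ih =>
      rw [List.foldl_concat, insertionTableau_concat]
      exact ih.rowsPass_tableauInsert (List.pairwise_lt_finRange d) (by simp) (by simp)
        (isTableau_insertionTableau w).sorted
  exact hrec i i j (by simp) hij

end Queues

/-! ### The large letters in the first rows -/

section Large

variable {d : ℕ}

theorem flatten_tableauInsert_perm {A : Type*} [LinearOrder A] (T : List (List A)) (x : A) :
    (tableauInsert T x).flatten.Perm (x :: T.flatten) := by
  induction T generalizing x with
  | nil => simp [tableauInsert]
  | cons r T ih =>
    have hrow := (rowInsert_perm x r).append_right T.flatten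
    rw [tableauInsert_eq, List.headD_cons, List.tail_cons, List.flatten_cons, List.flatten_cons]
    cases hy : (rowInsert x r).2 with
    | none => simpa [hy] using hrow
    | some y =>
      refine ((ih y).append_left _).trans (List.perm_middle.trans ?_)
      simpa [hy] using hrow

theorem flatten_insertionTableau_perm {A : Type*} [LinearOrder A] (w : List A) :
    (insertionTableau w).flatten.Perm w := by
  induction w using List.reverseRecOn with
  | nil => simp [insertionTableau]
  | append_singleton w x ih =>
    rw [insertionTableau_concat]
    exact (flatten_tableauInsert_perm _ x).trans
      ((ih.cons x).trans (List.perm_append_singleton x w).symm)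

theorem ColStrict.exists_lt_of_mem {A : Type*} [LinearOrder A] {r s : List A} (h : ColStrict r s)
    {b : A} (hb : b ∈ s) : ∃ a ∈ r, a < b := by
  obtain ⟨j, hj⟩ := List.mem_iff_getElem?.1 hb
  obtain ⟨a, ha, hab⟩ := h.exists_getElem? hj
  exact ⟨a, List.mem_of_getElem? ha, hab⟩

theorem IsTableau.le_of_mem_getD {T : List (List (Fin d))} (hT : IsTableau T) {n : ℕ} {b : Fin d}
    (hb : b ∈ T.getD n []) : n ≤ (b : ℕ) := by
  induction n generalizing b with
  | zero => exact Nat.zero_le _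
  | succ n ih =>
    have hlt : n + 1 < T.length := by
      by_contra! hn
      rw [List.getD_eq_default _ _ hn] at hb
      exact List.not_mem_nil hb
    rw [List.getD_eq_getElem _ _ hlt] at hb
    obtain ⟨a, ha, hab⟩ := (hT.isChain.getElem n hlt).exists_lt_of_mem hb
    refine (ih ?_).trans_lt hab
    rwa [List.getD_eq_getElem _ _ (Nat.lt_of_succ_lt hlt)]

theorem countP_flatten_eq_sum_range {A : Type*} {p : A → Bool} {m : ℕ} {T : List (List A)}
    (hT : ∀ n, m ≤ n → ∀ b ∈ T.getD n [], ¬ p b) :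
    T.flatten.countP p = ∑ i ∈ Finset.range m, (T.getD i []).countP p := by
  induction T generalizing m with
  | nil => simp
  | cons r T ih =>
    rw [List.flatten_cons, List.countP_append]
    cases m with
    | zero =>
      have hr : r.countP p = 0 := List.countP_eq_zero.2 (hT 0 le_rfl)
      simp [hr, ih (m := 0) fun n _ => hT (n + 1) (Nat.zero_le _)]
    | succ m =>
      rw [ih fun n hn => hT (n + 1) (Nat.succ_le_succ hn), Finset.sum_range_succ', add_comm]
      rfl

theorem sum_Iic_eq_sum_range (k : Fin d) (g : ℕ → ℕ) :
    ∑ i ∈ Finset.Iic k, g i = ∑ i ∈ Finset.range (k + 1), g i := by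
  rw [Nat.range_succ_eq_Iic, ← Fin.map_valEmbedding_Iic, Finset.sum_map]
  rfl

theorem countP_gt_eq_sum (k : Fin d) (r : List (Fin d)) :
    r.countP (k < ·) = ∑ j ∈ Finset.Ioi k, r.count j := by
  induction r with
  | nil => simp
  | cons a r ih => simp [List.countP_cons, List.count_cons, Finset.sum_add_distrib, ih]

/-- The number of letters larger than `k` in the rows up to `k`, where `s (i, j)` counts the letters
`j` of row `i`. -/
def largeCount (k : Fin d) (s : Fin d × Fin d → ℕ) : ℕ :=
  ∑ i ∈ Finset.Iic k, ∑ j ∈ Finset.Ioi k, s (i, j)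

theorem topSize_insertionTableau_eq (k : Fin d) (w : List (Fin d)) :
    topSize (k + 1) (insertionTableau w) =
      largeCount k (w.foldl queueInsert 0) + w.countP (· ≤ k) := by
  have hsmall : w.countP (· ≤ k) =
      ∑ i ∈ Finset.Iic k, ((insertionTableau w).getD i []).countP (· ≤ k) := by
    rw [sum_Iic_eq_sum_range k fun i => ((insertionTableau w).getD i []).countP (· ≤ k),
      ← (flatten_insertionTableau_perm w).countP_eq]
    refine countP_flatten_eq_sum_range fun n hn b hb => ?_
    have hnb := (isTableau_insertionTableau w).le_of_mem_getD hb
    rw [decide_eq_true_eq, Fin.le_def]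
    omega
  rw [topSize, ← sum_Iic_eq_sum_range k fun i => ((insertionTableau w).getD i []).length, hsmall,
    largeCount, ← Finset.sum_add_distrib]
  refine Finset.sum_congr rfl fun i hi => ?_
  rw [List.length_eq_countP_add_countP (fun j => decide (k < j)), countP_gt_eq_sum]
  congr 1
  · exact Finset.sum_congr rfl fun j hj =>
      (foldl_queueInsert_eq_count w ((Finset.mem_Iic.1 hi).trans_lt (Finset.mem_Ioi.1 hj))).symm
  · exact List.countP_congr fun j _ => by simp only [decide_eq_true_eq, not_lt]

/-- A letter `x ≤ k` put in front of the word increases both sides of `topSize_insertionTableau_eq`,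
because it is not larger than any letter of row `x`. -/
theorem largeCount_le_cons (k x : Fin d) (w : List (Fin d)) :
    largeCount k (w.foldl queueInsert 0) ≤ largeCount k ((x :: w).foldl queueInsert 0) := by
  have hbot : IsBot (⟨0, k.pos⟩ : Fin d) := fun b => Fin.le_def.2 (Nat.zero_le _)
  have hw := topSize_insertionTableau_eq k w
  have hxw := topSize_insertionTableau_eq k (x :: w)
  rw [List.countP_cons] at hxw
  by_cases hx : x ≤ k
  · have hlt := topSize_insertionTableau_lt_cons hbot (k := k + 1) (m := x)
      (Nat.lt_succ_of_le hx) fun b hb => (isTableau_insertionTableau w).le_of_mem_getD hb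
    rw [if_pos (by simpa using hx)] at hxw
    omega
  · have hle := topSize_insertionTableau_le_cons hbot (k + 1) x w
    rw [if_neg (by simpa using hx)] at hxw
    omega

end Large

/-! ### Runs along random words -/

section WordSum

open scoped ENNReal

variable {A : Type*} [Fintype A] {R : Type*} [CommSemiring R]

/-- The sum of `f w` over the words `w` of length `n`, each weighted by the product of the weights
`a x` of its letters `x`. -/
def wordSum (a : A → R) : ℕ → (List A → R) → R
  | 0, f => f []
  | n + 1, f => ∑ x, a x * wordSum a n fun w => f (x :: w)

theorem wordSum_add (a : A → R) (n : ℕ) (f g : List A → R) :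
    wordSum a n (fun w => f w + g w) = wordSum a n f + wordSum a n g := by
  induction n generalizing f g with
  | zero => rfl
  | succ n ih => simp only [wordSum, ih, mul_add, Finset.sum_add_distrib]

theorem wordSum_const {a : A → R} (ha : ∑ x, a x = 1) (n : ℕ) (c : R) :
    wordSum a n (fun _ => c) = c := by
  induction n with
  | zero => rfl
  | succ n ih => simp only [wordSum, ih, ← Finset.sum_mul, ha, one_mul]

theorem wordSum_append (a : A → R) (m n : ℕ) (f : List A → R) :
    wordSum a (m + n) f = wordSum a m fun u => wordSum a n fun v => f (u ++ v) := by
  induction m generalizing f with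
  | zero => rw [Nat.zero_add]; rfl
  | succ m ih =>
    rw [Nat.add_right_comm]
    simp only [wordSum, ih, List.cons_append]

theorem wordSum_ite_eq [DecidableEq A] (a : A → R) (u : List A) (c : R) :
    wordSum a u.length (fun w => if w = u then c else 0) = (u.map a).prod * c := by
  have hzero (n : ℕ) : wordSum a n (fun _ => 0) = 0 := by
    induction n with
    | zero => rfl
    | succ n ih => simp only [wordSum, ih, mul_zero, Finset.sum_const_zero]
  induction u with
  | nil => simp [wordSum]
  | cons y u ih =>
    rw [List.length_cons, wordSum, Finset.sum_eq_single y]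
    · simp [ih, mul_assoc]
    · intro x _ hx
      simp [hx, hzero]
    · simp

theorem wordSum_mono (a : A → ℝ≥0∞) {n : ℕ} {f g : List A → ℝ≥0∞} (h : ∀ w, f w ≤ g w) :
    wordSum a n f ≤ wordSum a n g := by
  induction n generalizing f g with
  | zero => exact h []
  | succ n ih => exact Finset.sum_le_sum fun x _ => by gcongr; exact ih fun w => h _

theorem monotone_wordSum {a : A → ℝ≥0∞} (ha : ∑ x, a x = 1) {f : List A → ℝ≥0∞}
    (hf : ∀ x w, f w ≤ f (x :: w)) : Monotone fun n => wordSum a n f := by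
  refine monotone_nat_of_le_succ fun n => ?_
  calc wordSum a n f = ∑ x, a x * wordSum a n f := by rw [← Finset.sum_mul, ha, one_mul]
    _ ≤ wordSum a (n + 1) f :=
      Finset.sum_le_sum fun x _ => by gcongr; exact wordSum_mono a fun w => hf x w

/-- The words other than `u` contribute at least `c` each. -/
theorem prod_mul_add_le_wordSum {a : A → ℝ≥0∞} (ha : ∑ x, a x = 1) (u : List A) {c : ℝ≥0∞}
    {f : List A → ℝ≥0∞} (hf : ∀ w, c ≤ f w) :
    (u.map a).prod * f u + c ≤ wordSum a u.length f + (u.map a).prod * c := by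
  classical
  rw [← wordSum_const ha u.length c, ← wordSum_ite_eq, ← wordSum_add, wordSum_const ha,
    ← wordSum_ite_eq, ← wordSum_add]
  refine wordSum_mono a fun w => ?_
  split_ifs with hw
  · rw [hw]
  · simpa using hf w

theorem prod_map_le_one {a : A → ℝ≥0∞} (ha : ∑ x, a x = 1) (u : List A) : (u.map a).prod ≤ 1 := by
  simpa [wordSum_const ha] using prod_mul_add_le_wordSum ha u (c := 0) (f := fun _ => 1) (by simp)

theorem le_foldl_append {A S : Type*} {step : S → A → S} {s₀ : S} {f : S → ℝ≥0∞}
    (hf : ∀ x w, f (List.foldl step s₀ w) ≤ f (List.foldl step s₀ (x :: w))) (u w : List A) :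
    f (w.foldl step s₀) ≤ f (w.foldl step (u.foldl step s₀)) := by
  rw [← List.foldl_append]
  induction u with
  | nil => exact le_rfl
  | cons x u ih => exact ih.trans (hf x _)

/-- After `u.length` further steps from `s₀`, the run has the law of the run from the end of `u`
with the probability of `u`, and is not worse than the run from `s₀` otherwise. -/
theorem tendsto_wordSum_foldl {S : Type*} {a : A → ℝ≥0∞} (ha : ∑ x, a x = 1) {step : S → A → S}
    {s₀ : S} {f : S → ℝ≥0∞}
    (hf : ∀ x w, f (List.foldl step s₀ w) ≤ f (List.foldl step s₀ (x :: w))) {L : ℝ≥0∞}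
    (hL : L ≠ ∞)
    (hlim : Tendsto (fun n => wordSum a n fun w => f (w.foldl step s₀)) atTop (𝓝 L)) {u : List A}
    (hu : ∀ x ∈ u, a x ≠ 0) :
    Tendsto (fun n => wordSum a n fun w => f (w.foldl step (u.foldl step s₀))) atTop (𝓝 L) := by
  set E : ℕ → ℝ≥0∞ := fun n => wordSum a n fun w => f (w.foldl step s₀)
  set G : ℕ → ℝ≥0∞ := fun n => wordSum a n fun w => f (w.foldl step (u.foldl step s₀))
  set P : ℝ≥0∞ := (u.map a).prod
  have hP : P ≠ 0 := List.prod_ne_zero (by simpa using hu)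
  have hPtop : P ≠ ∞ := ((prod_map_le_one ha u).trans_lt ENNReal.one_lt_top).ne
  have hE : ∀ n, E n ≤ L := fun n => (monotone_wordSum ha hf).ge_of_tendsto hlim n
  have hstep (n : ℕ) : P * G n + E n ≤ E (u.length + n) + P * E n := by
    have happend : E (u.length + n) = wordSum a u.length fun v =>
        wordSum a n fun w => f (w.foldl step (v.foldl step s₀)) := by
      simp only [E, wordSum_append, List.foldl_append]
    rw [happend]
    exact prod_mul_add_le_wordSum ha u fun v => wordSum_mono a fun w => le_foldl_append hf v w
  have hupper (n : ℕ) : G n ≤ (E (u.length + n) - E n) / P + E n := by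
    have hcancel : P * G n ≤ E (u.length + n) - E n + P * E n := by
      refine (ENNReal.add_le_add_iff_right (ne_top_of_le_ne_top hL (hE n))).1 ((hstep n).trans ?_)
      rw [add_right_comm]
      gcongr
      exact le_tsub_add
    rwa [← ENNReal.mul_le_mul_iff_right hP hPtop, mul_add, ENNReal.mul_div_cancel hP hPtop]
  have hshift : Tendsto (fun n => E (u.length + n)) atTop (𝓝 L) := by
    simpa only [add_comm] using (tendsto_add_atTop_iff_nat u.length).2 hlim
  have hupper_lim : Tendsto (fun n => (E (u.length + n) - E n) / P + E n) atTop (𝓝 L) := by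
    simpa using (ENNReal.Tendsto.div_const (ENNReal.Tendsto.sub hshift hlim (.inl hL))
      (.inr hP)).add hlim
  exact tendsto_of_tendsto_of_tendsto_of_le_of_le hlim hupper_lim
    (fun n => wordSum_mono a fun w => le_foldl_append hf u w) hupper

theorem tendsto_tsum_mul {S : Type*} {π : S → ℝ≥0∞} (hπ : ∑' s, π s ≠ ∞) {K : ℝ≥0∞} (hK : K ≠ ∞)
    {g : ℕ → S → ℝ≥0∞} (hg : ∀ n s, g n s ≤ K) {L : ℝ≥0∞}
    (hlim : ∀ s, π s ≠ 0 → Tendsto (fun n => g n s) atTop (𝓝 L)) :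
    Tendsto (fun n => ∑' s, π s * g n s) atTop (𝓝 (∑' s, π s * L)) := by
  let : MeasurableSpace S := ⊤
  simp only [← lintegral_count]
  refine tendsto_lintegral_of_dominated_convergence (fun s => π s * K)
    (fun n => measurable_from_top) (fun n => ae_of_all _ fun s => mul_le_mul_right (hg n s) _) ?_
    (ae_of_all _ fun s => ?_)
  · rw [lintegral_count, ENNReal.tsum_mul_right]
    exact ENNReal.mul_ne_top hπ hK
  · by_cases hs : π s = 0
    · simp [hs]
    · exact ENNReal.Tendsto.const_mul (hlim s hs) (.inr (ENNReal.ne_top_of_tsum_ne_top hπ s))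

theorem tsum_mul_eq_iSup_min {S : Type*} (π f : S → ℝ≥0∞) :
    ∑' s, π s * f s = ⨆ r : ℕ, ∑' s, π s * min (f s) r := by
  let : MeasurableSpace S := ⊤
  have hmin (s : S) : π s * f s = ⨆ r : ℕ, π s * min (f s) r := by
    rw [← ENNReal.mul_iSup, ← inf_iSup_eq, ENNReal.iSup_natCast, inf_top_eq]
  simp only [hmin, ← lintegral_count]
  exact lintegral_iSup (fun r => measurable_from_top) fun r r' hr s => by
    dsimp only
    gcongr

/-- A probability vector `π` on the states that is invariant under a step with a random letter,
where the letter `x` has the weight `a x`. -/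
structure IsStationaryLaw {S : Type*} (a : A → ℝ≥0∞) (step : S → A → S) (π : S → ℝ≥0∞) :
    Prop where
  tsum_eq_one : ∑' s, π s = 1
  tsum_step : ∀ f : S → ℝ≥0∞, ∑' s, π s * ∑ x, a x * f (step s x) = ∑' s, π s * f s

namespace IsStationaryLaw

variable {S : Type*} {a : A → ℝ≥0∞} {step : S → A → S} {π : S → ℝ≥0∞}

theorem tsum_mul_const (h : IsStationaryLaw a step π) (c : ℝ≥0∞) : ∑' s, π s * c = c := by
  rw [ENNReal.tsum_mul_right, h.tsum_eq_one, one_mul]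

theorem tsum_wordSum (h : IsStationaryLaw a step π) (n : ℕ) (f : S → ℝ≥0∞) :
    ∑' s, π s * wordSum a n (fun w => f (w.foldl step s)) = ∑' s, π s * f s := by
  induction n with
  | zero => rfl
  | succ n ih =>
    simp only [wordSum, List.foldl_cons]
    rw [h.tsum_step fun s => wordSum a n fun w => f (w.foldl step s)]
    exact ih

variable {s₀ : S} {f : S → ℝ≥0∞}

theorem wordSum_le (h : IsStationaryLaw a step π)
    (hreach : ∀ s, π s ≠ 0 → ∃ u : List A, (∀ x ∈ u, a x ≠ 0) ∧ u.foldl step s₀ = s)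
    (hf : ∀ x w, f (List.foldl step s₀ w) ≤ f (List.foldl step s₀ (x :: w))) (n : ℕ) :
    wordSum a n (fun w => f (w.foldl step s₀)) ≤ ∑' s, π s * f s := by
  rw [← h.tsum_mul_const (wordSum a n _), ← h.tsum_wordSum n f]
  refine ENNReal.tsum_le_tsum fun s => ?_
  by_cases hs : π s = 0
  · simp [hs]
  · obtain ⟨u, -, rfl⟩ := hreach s hs
    gcongr
    exact wordSum_mono a fun w => le_foldl_append hf u w

theorem tendsto_wordSum_of_le (h : IsStationaryLaw a step π) (ha : ∑ x, a x = 1)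
    (hreach : ∀ s, π s ≠ 0 → ∃ u : List A, (∀ x ∈ u, a x ≠ 0) ∧ u.foldl step s₀ = s)
    (hf : ∀ x w, f (List.foldl step s₀ w) ≤ f (List.foldl step s₀ (x :: w))) {K : ℝ≥0∞}
    (hK : K ≠ ∞) (hfK : ∀ s, f s ≤ K) :
    Tendsto (fun n => wordSum a n fun w => f (w.foldl step s₀)) atTop (𝓝 (∑' s, π s * f s)) := by
  have hbound (n : ℕ) (s : S) : wordSum a n (fun w => f (w.foldl step s)) ≤ K :=
    (wordSum_mono a fun w => hfK _).trans (wordSum_const ha n K).le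
  have hlim := tendsto_atTop_iSup (monotone_wordSum ha hf)
  have hL : ⨆ n, wordSum a n (fun w => f (w.foldl step s₀)) ≠ ∞ :=
    ne_top_of_le_ne_top hK (iSup_le fun n => hbound n s₀)
  have htsum := tendsto_tsum_mul (π := π) (by simp [h.tsum_eq_one]) hK hbound fun s hs => by
    obtain ⟨u, hu, rfl⟩ := hreach s hs
    exact tendsto_wordSum_foldl ha hf hL hlim hu
  simp only [h.tsum_wordSum, h.tsum_mul_const] at htsum
  rwa [tendsto_nhds_unique tendsto_const_nhds htsum]

theorem tendsto_wordSum (h : IsStationaryLaw a step π) (ha : ∑ x, a x = 1)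
    (hreach : ∀ s, π s ≠ 0 → ∃ u : List A, (∀ x ∈ u, a x ≠ 0) ∧ u.foldl step s₀ = s)
    (hf : ∀ x w, f (List.foldl step s₀ w) ≤ f (List.foldl step s₀ (x :: w))) :
    Tendsto (fun n => wordSum a n fun w => f (w.foldl step s₀)) atTop (𝓝 (∑' s, π s * f s)) := by
  convert tendsto_atTop_iSup (monotone_wordSum ha hf) using 2
  refine le_antisymm ?_ (iSup_le fun n => h.wordSum_le hreach hf n)
  rw [tsum_mul_eq_iSup_min]
  refine iSup_le fun r => ?_
  refine le_of_tendsto' (h.tendsto_wordSum_of_le ha hreach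
    (fun x w => min_le_min_right _ (hf x w)) (ENNReal.natCast_ne_top r) fun s => min_le_right _ _)
    fun n => ?_
  exact le_iSup_of_le n (wordSum_mono a fun w => min_le_left _ _)

end IsStationaryLaw

end WordSum

/-! ### Products of geometric laws -/

section Geometric

open scoped ENNReal

theorem tsum_pi_prod {ι : Type*} [Fintype ι] (g : ι → ℕ → ℝ≥0∞) :
    ∑' s : ι → ℕ, ∏ q, g q (s q) = ∏ q, ∑' m, g q m := by
  have hfin (n : ℕ) (g : Fin n → ℕ → ℝ≥0∞) :
      ∑' s : Fin n → ℕ, ∏ i, g i (s i) = ∏ i, ∑' m, g i m := by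
    induction n with
    | zero => simp
    | succ n ih =>
      rw [← (Fin.consEquiv fun _ : Fin (n + 1) => ℕ).tsum_eq, ENNReal.tsum_prod',
        Fin.prod_univ_succ, ← ih, ← ENNReal.tsum_mul_right]
      simp only [← ENNReal.tsum_mul_left, Fin.prod_univ_succ]
      rfl
  set e := Fintype.equivFin ι
  rw [← (Equiv.arrowCongr e (Equiv.refl ℕ)).symm.tsum_eq, ← e.symm.prod_comp,
    ← hfin _ fun i => g (e.symm i)]
  refine tsum_congr fun s => ?_
  rw [← e.symm.prod_comp]
  simp [Equiv.arrowCongr]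

theorem tsum_geometric_law {r : ℝ≥0∞} (hr : r < 1) : ∑' m : ℕ, (1 - r) * r ^ m = 1 := by
  rw [ENNReal.tsum_mul_left, ENNReal.tsum_geometric,
    ENNReal.mul_inv_cancel (tsub_pos_of_lt hr).ne' (by simp)]

theorem tsum_geometric_law_mul {r : ℝ≥0∞} (hr : r < 1) :
    ∑' m : ℕ, (1 - r) * r ^ m * m = r / (1 - r) := by
  lift r to NNReal using hr.ne_top
  have hlt : r < 1 := by exact_mod_cast hr
  have hne : (1 - r : ℝ) ≠ 0 := (sub_pos.2 (by exact_mod_cast hlt)).ne'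
  have hsum : HasSum (fun m : ℕ => (1 - r) * r ^ m * m) (r / (1 - r)) := by
    rw [← NNReal.hasSum_coe]
    push_cast [hlt.le]
    have hmean := (hasSum_coe_mul_geometric_of_norm_lt_one
      (by simpa using hlt : ‖(r : ℝ)‖ < 1)).mul_left (1 - r : ℝ)
    have hvalue : (1 - r : ℝ) * (r / (1 - r) ^ 2) = r / (1 - r) := by field_simp
    rw [hvalue] at hmean
    exact hmean.congr_fun fun m => by ring
  simpa [ENNReal.coe_div (tsub_pos_of_lt hlt).ne'] using (ENNReal.hasSum_coe.2 hsum).tsum_eq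

variable {ι : Type*} [Fintype ι]

/-- The product of the geometric laws with ratios `ρ q`, as a weight on `ι → ℕ`. -/
noncomputable def geomWeight (ρ : ι → ℝ≥0∞) (s : ι → ℕ) : ℝ≥0∞ :=
  ∏ q, (1 - ρ q) * ρ q ^ s q

theorem tsum_geomWeight {ρ : ι → ℝ≥0∞} (hρ : ∀ q, ρ q < 1) : ∑' s, geomWeight ρ s = 1 :=
  (tsum_pi_prod fun q m => (1 - ρ q) * ρ q ^ m).trans
    (Finset.prod_eq_one fun q _ => tsum_geometric_law (hρ q))

theorem tsum_geomWeight_mul {ρ : ι → ℝ≥0∞} (hρ : ∀ q, ρ q < 1) (p : ι) :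
    ∑' s, geomWeight ρ s * s p = ρ p / (1 - ρ p) := by
  classical
  have hprod (s : ι → ℕ) : geomWeight ρ s * s p =
      ∏ q, ((1 - ρ q) * ρ q ^ s q * if q = p then (s q : ℝ≥0∞) else 1) := by
    rw [Finset.prod_mul_distrib, Finset.prod_ite_eq', if_pos (Finset.mem_univ p), geomWeight]
  rw [tsum_congr hprod,
    tsum_pi_prod fun q m => (1 - ρ q) * ρ q ^ m * if q = p then (m : ℝ≥0∞) else 1,
    Finset.prod_eq_single p]
  · simpa using tsum_geometric_law_mul (hρ p)
  · intro q _ hq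
    simpa [hq] using tsum_geometric_law (hρ q)
  · simp

theorem geomWeight_update_succ [DecidableEq ι] (ρ : ι → ℝ≥0∞) (s : ι → ℕ) (p : ι) :
    geomWeight ρ (Function.update s p (s p + 1)) = geomWeight ρ s * ρ p := by
  rw [geomWeight, geomWeight, ← Finset.mul_prod_erase _ _ (Finset.mem_univ p),
    ← Finset.mul_prod_erase _ _ (Finset.mem_univ p), Function.update_self, pow_succ, ← mul_assoc,
    mul_right_comm]
  congr 2
  refine Finset.prod_congr rfl fun q hq => ?_
  rw [Function.update_of_ne (Finset.ne_of_mem_erase hq)]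

theorem eq_zero_of_geomWeight_ne_zero {ρ : ι → ℝ≥0∞} {s : ι → ℕ} (hs : geomWeight ρ s ≠ 0) {q : ι}
    (hq : ρ q = 0) : s q = 0 := by
  by_contra hsq
  exact hs (Finset.prod_eq_zero (Finset.mem_univ q) (by simp [hq, hsq]))

end Geometric

/-! ### The stationary law of the queues -/

section Stationary

open scoped ENNReal

variable {d : ℕ}

theorem cellsPass_bijective {i : Fin d} {l : List (Fin d)} (hl : ∀ j ∈ l, i < j) :
    Function.Bijective (cellsPass i l) := by
  induction l with
  | nil => exact Function.bijective_id
  | cons j l ih =>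
    rw [List.forall_mem_cons] at hl
    exact (ih hl.2).comp (cellMove_involutive hl.1.ne).bijective

theorem rowsPass_bijective (l : List (Fin d)) : Function.Bijective (rowsPass l) := by
  induction l with
  | nil => exact Function.bijective_id
  | cons i l ih => exact ih.comp (cellsPass_bijective (by simp))

/-- The traffic intensity of the queue at `q`: the ratio of the weight of the letter that it holds
to the weight of the idle token. -/
noncomputable def intensity (a : Fin d → ℝ≥0∞) (q : Fin d × Fin d) : ℝ≥0∞ :=
  if q.1 < q.2 then a q.2 / a q.1 else 0

/-- The weight of the queues and an independent token, whose lengths have geometric laws and whose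
letter has the weight given by `a`. -/
noncomputable def tokenWeight (a : Fin d → ℝ≥0∞) (p : (Fin d × Fin d → ℕ) × Fin d) : ℝ≥0∞ :=
  geomWeight (intensity a) p.1 * a p.2

variable {a : Fin d → ℝ≥0∞}

theorem intensity_lt_one (hanti : StrictAnti a) (q : Fin d × Fin d) :
    intensity a q < 1 := by
  unfold intensity
  split_ifs with hq
  · exact ENNReal.div_lt_of_lt_mul (by simpa using hanti hq)
  · exact one_pos

theorem tokenWeight_cellMove (ha : ∀ i, a i ≠ ∞) (hanti : StrictAnti a) {i j : Fin d} (hij : i < j)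
    (p : (Fin d × Fin d → ℕ) × Fin d) : tokenWeight a (cellMove i j p) = tokenWeight a p := by
  have join (p : (Fin d × Fin d → ℕ) × Fin d) (hp : p.2 = j) :
      tokenWeight a (cellMove i j p) = tokenWeight a p := by
    have hratio : intensity a (i, j) * a i = a j := by
      rw [intensity, if_pos hij, ENNReal.div_mul_cancel (hanti hij).ne_bot (ha i)]
    rw [cellMove, if_pos hp, tokenWeight, tokenWeight, geomWeight_update_succ, mul_assoc, hratio,
      hp]
  by_cases hjoin : p.2 = j
  · exact join p hjoin
  by_cases hrelease : p.2 = i ∧ 0 < p.1 (i, j)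
  · have hback := join (cellMove i j p) (by simp [cellMove, hrelease, hij.ne])
    rw [cellMove_involutive hij.ne] at hback
    exact hback.symm
  · simp only [cellMove, hjoin, hrelease, if_false]

theorem tokenWeight_cellsPass (ha : ∀ i, a i ≠ ∞) (hanti : StrictAnti a) {i : Fin d}
    {l : List (Fin d)} (hl : ∀ j ∈ l, i < j) (p : (Fin d × Fin d → ℕ) × Fin d) :
    tokenWeight a (cellsPass i l p) = tokenWeight a p := by
  induction l generalizing p with
  | nil => rfl
  | cons j l ih =>
    rw [List.forall_mem_cons] at hl
    exact (ih hl.2 _).trans (tokenWeight_cellMove ha hanti hl.1 p)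

theorem tokenWeight_rowsPass (ha : ∀ i, a i ≠ ∞) (hanti : StrictAnti a) (l : List (Fin d))
    (p : (Fin d × Fin d → ℕ) × Fin d) : tokenWeight a (rowsPass l p) = tokenWeight a p := by
  induction l generalizing p with
  | nil => rfl
  | cons i l ih => exact (ih _).trans (tokenWeight_cellsPass ha hanti (by simp) p)

theorem isStationaryLaw_geomWeight (ha : ∑ i, a i = 1) (hanti : StrictAnti a) :
    IsStationaryLaw a queueInsert (geomWeight (intensity a)) := by
  have hfin : ∀ i, a i ≠ ∞ := by
    simpa using (ENNReal.sum_ne_top (s := Finset.univ) (f := a)).1 (by simp [ha])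
  refine ⟨tsum_geomWeight (intensity_lt_one hanti), fun f => ?_⟩
  have hpass : ∑' p, tokenWeight a p * f (rowsPass (List.finRange d) p).1 =
      ∑' p, tokenWeight a p * f p.1 := by
    rw [← (Equiv.ofBijective _ (rowsPass_bijective (List.finRange d))).tsum_eq fun p =>
      tokenWeight a p * f p.1]
    simp only [Equiv.ofBijective_apply, tokenWeight_rowsPass hfin hanti]
  rw [ENNReal.tsum_prod', ENNReal.tsum_prod'] at hpass
  simp only [tokenWeight, tsum_fintype, mul_assoc, ← Finset.mul_sum, ← Finset.sum_mul, ha,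
    one_mul] at hpass
  exact hpass

theorem tsum_geomWeight_mul_largeCount (ha : ∀ i, a i ≠ ∞) (hanti : StrictAnti a) (k : Fin d) :
    ∑' s, geomWeight (intensity a) s * largeCount k s =
      ∑ i ∈ Finset.Iic k, ∑ j ∈ Finset.Ioi k, a j / (a i - a j) := by
  simp only [largeCount, Nat.cast_sum, Finset.mul_sum]
  rw [Summable.tsum_finsetSum fun _ _ => ENNReal.summable]
  refine Finset.sum_congr rfl fun i hi => ?_
  rw [Summable.tsum_finsetSum fun _ _ => ENNReal.summable]
  refine Finset.sum_congr rfl fun j hj => ?_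
  have hij : i < j := (Finset.mem_Iic.1 hi).trans_lt (Finset.mem_Ioi.1 hj)
  have hi0 : a i ≠ 0 := (hanti hij).ne_bot
  have hone : 1 - a j / a i = (a i - a j) / a i := by
    rw [ENNReal.sub_div fun _ _ => hi0, ENNReal.div_self hi0 (ha i)]
  rw [tsum_geomWeight_mul (intensity_lt_one hanti), intensity, if_pos hij, hone]
  exact ENNReal.mul_div_mul_right _ _ (ENNReal.inv_ne_zero.2 (ha i)) (ENNReal.inv_ne_top.2 hi0)

theorem exists_rowPass_of_rowsPass_eq {i : Fin d} {p : (Fin d × Fin d → ℕ) × Fin d}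
    {s : Fin d × Fin d → ℕ} (hp : rowsPass (List.finRange d) p = (s, i)) :
    ∃ q : (Fin d × Fin d → ℕ) × Fin d, rowPass i q = (s, i) ∧
      ∀ m, i ≤ m → ∀ j, q.1 (m, j) = p.1 (m, j) := by
  obtain ⟨l₁, l₂, hl⟩ := List.append_of_mem (List.mem_finRange i)
  have hsorted := List.pairwise_lt_finRange d
  rw [hl, List.pairwise_append, List.pairwise_cons] at hsorted
  obtain ⟨-, ⟨hl₂, -⟩, hl₁⟩ := hsorted
  rw [hl, rowsPass, List.foldl_append, List.foldl_cons] at hp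
  refine ⟨rowsPass l₁ p, (rowsPass_bijective l₂).injective ?_, fun m hm j =>
    rowsPass_apply_of_notMem (fun hml => (hl₁ m hml i List.mem_cons_self).not_ge hm) j p⟩
  rw [rowsPass_of_lt hl₂]
  exact hp

theorem rowPass_release {i j : Fin d} (hij : i < j) {q : (Fin d × Fin d → ℕ) × Fin d}
    {s : Fin d × Fin d → ℕ} (hq : rowPass i q = (s, i)) (hj : 0 < s (i, j)) :
    (∀ m, m ≠ i → q.1 (i, m) ≤ s (i, m)) ∧ ∃ m, q.1 (i, m) < s (i, m) := by
  have hconserve (m : Fin d) (hm : m ≠ i) :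
      s (i, m) = q.1 (i, m) + if q.2 = m then 1 else 0 := by
    have h := cellsPass_conserves hm ((List.finRange d).filter (i < ·)) q
    rwa [← rowPass, hq, if_neg hm.symm, add_zero] at h
  refine ⟨fun m hm => (hconserve m hm).symm ▸ Nat.le_add_right _ _, q.2, ?_⟩
  have hgt : i < q.2 := by
    by_contra! hle
    rcases hle.lt_or_eq with hlt | heq
    · have hrest : q = (s, i) := (rowPass_of_lt hlt q.1).symm.trans hq
      simp [hrest] at hlt
    · have hsnd := rowPass_snd heq.ge q.1
      rw [Prod.mk.eta, hq, heq] at hsnd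
      have hpos : 0 < q.1 (i, j) := by simpa [hconserve j hij.ne', heq, hij.ne] using hj
      cases hfind : (List.finRange d).find? fun j => i < j ∧ 0 < q.1 (i, j) with
      | none => simpa [hij, hpos.ne'] using List.find?_eq_none.1 hfind j (List.mem_finRange j)
      | some m =>
        have hm := List.find?_some hfind
        rw [hfind, Option.getD_some] at hsnd
        simp [← hsnd] at hm
  simp [hconserve q.2 hgt.ne']

theorem eq_zero_of_geomWeight_intensity_ne_zero {s : Fin d × Fin d → ℕ}
    (hs : geomWeight (intensity a) s ≠ 0) {i j : Fin d} (hij : ¬i < j) : s (i, j) = 0 :=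
  eq_zero_of_geomWeight_ne_zero hs (if_neg hij)

theorem exists_queueInsert_eq (ha : ∀ i, a i ≠ ∞) (hanti : StrictAnti a) {s : Fin d × Fin d → ℕ}
    (hs : geomWeight (intensity a) s ≠ 0) {i j : Fin d} (hij : i < j) (hj : 0 < s (i, j)) :
    ∃ s' x, queueInsert s' x = s ∧ geomWeight (intensity a) s' ≠ 0 ∧ a x ≠ 0 ∧
      (∀ m, i < m → Function.curry s' m = Function.curry s m) ∧
      Function.curry s' i < Function.curry s i := by
  obtain ⟨⟨s', x⟩, hpass⟩ := (rowsPass_bijective (List.finRange d)).surjective (s, i)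
  have hweight : geomWeight (intensity a) s' * a x ≠ 0 := by
    have h := tokenWeight_rowsPass ha hanti (List.finRange d) (s', x)
    rw [hpass] at h
    exact h.symm.trans_ne (mul_ne_zero hs (hanti hij).ne_bot)
  obtain ⟨hs', hx⟩ := mul_ne_zero_iff.1 hweight
  obtain ⟨q, hrow, hq⟩ := exists_rowPass_of_rowsPass_eq hpass
  obtain ⟨hle, m, hlt⟩ := rowPass_release hij hrow hj
  refine ⟨s', x, by rw [queueInsert, hpass], hs', hx, fun b hb => funext fun c => ?_,
    Pi.lt_def.2 ⟨fun c => ?_, m, (hq i le_rfl m).symm.trans_lt hlt⟩⟩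
  · have h := cellsPass_apply_of_ne hb.ne' c ((List.finRange d).filter (i < ·)) q
    rw [← rowPass, hrow, hq b hb.le] at h
    exact h.symm
  · by_cases hc : i < c
    · exact (hq i le_rfl c).symm.trans_le (hle c hc.ne')
    · exact (eq_zero_of_geomWeight_intensity_ne_zero hs' hc).trans_le (Nat.zero_le _)

theorem exists_foldl_queueInsert_eq (ha : ∀ i, a i ≠ ∞) (hanti : StrictAnti a)
    {s : Fin d × Fin d → ℕ} (hs : geomWeight (intensity a) s ≠ 0) :
    ∃ u : List (Fin d), (∀ x ∈ u, a x ≠ 0) ∧ u.foldl queueInsert 0 = s := by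
  have hwf : WellFounded (InvImage (Pi.Lex (· > ·) (· < ·))
      (Function.curry : (Fin d × Fin d → ℕ) → Fin d → Fin d → ℕ)) :=
    InvImage.wf _ (Pi.Lex.wellFounded _ fun _ => wellFounded_lt)
  induction s using hwf.induction with
  | _ s ih =>
  by_cases hempty : s = 0
  · exact ⟨[], by simp, hempty.symm⟩
  obtain ⟨⟨i, j⟩, hsij⟩ := Function.ne_iff.1 hempty
  have hij : i < j := by
    by_contra h
    exact hsij (eq_zero_of_geomWeight_intensity_ne_zero hs h)
  obtain ⟨s', x, rfl, hs', hx, hlater, hrow⟩ :=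
    exists_queueInsert_eq ha hanti hs hij (Nat.pos_of_ne_zero hsij)
  obtain ⟨u, hu, rfl⟩ := ih s' ⟨i, hlater, hrow⟩ hs'
  exact ⟨u ++ [x], by simpa [or_imp, forall_and] using ⟨hu, hx⟩, List.foldl_concat ..⟩

end Stationary

/-! ### The excess as an expectation over words -/

section Excess

open scoped ENNReal

variable {d : ℕ}

theorem sum_prod_ofFn_eq_wordSum {A R : Type*} [Fintype A] [CommSemiring R] (a : A → R) (n : ℕ)
    (f : List A → R) : ∑ w : Fin n → A, (∏ i, a (w i)) * f (List.ofFn w) = wordSum a n f := by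
  induction n generalizing f with
  | zero => simp [wordSum]
  | succ n ih =>
    rw [← (Fin.consEquiv fun _ : Fin (n + 1) => A).sum_comp, Fintype.sum_prod_type, wordSum]
    simp only [← ih, Finset.mul_sum, ← mul_assoc, Fin.prod_univ_succ, List.ofFn_succ]
    rfl

theorem continuous_wordSum {A : Type*} [Fintype A] (n : ℕ) (f : List A → ℝ) :
    Continuous fun a : A → ℝ => wordSum a n f := by
  simp only [← sum_prod_ofFn_eq_wordSum]
  fun_prop

theorem wordSum_countP {α : Fin d → ℝ} (hα : ∑ i, α i = 1) (k : Fin d) (n : ℕ) :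
    wordSum α n (fun w => (w.countP (· ≤ k) : ℝ)) = (∑ i ∈ Finset.Iic k, α i) * n := by
  have hletter : ∑ x, α x * (if x ≤ k then 1 else 0) = ∑ i ∈ Finset.Iic k, α i := by
    simp [← Finset.sum_filter, Finset.filter_ge_eq_Iic]
  induction n with
  | zero => simp [wordSum]
  | succ n ih =>
    simp only [wordSum, List.countP_cons, Nat.cast_add, wordSum_add, ih, mul_add,
      Finset.sum_add_distrib, ← Finset.sum_mul, hα, wordSum_const hα, decide_eq_true_eq,
      Nat.cast_ite, Nat.cast_one, Nat.cast_zero, hletter]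
    ring

theorem letterLaw_singleton (α : Fin d → ℝ) (x : Fin d) :
    letterLaw α {x} = ENNReal.ofReal (α x) := by
  simp [letterLaw, Set.indicator_apply]

instance isFiniteMeasure_letterLaw (α : Fin d → ℝ) : IsFiniteMeasure (letterLaw α) :=
  ⟨by simp [letterLaw]⟩

instance isFiniteMeasure_wordLaw (n : ℕ) (α : Fin d → ℝ) : IsFiniteMeasure (wordLaw n α) :=
  inferInstanceAs (IsFiniteMeasure (Measure.pi _))

theorem wordLaw_real_singleton {α : Fin d → ℝ} (hα : 0 ≤ α) {n : ℕ} (w : Fin n → Fin d) :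
    (wordLaw n α).real {w} = ∏ i, α (w i) := by
  simp [Measure.real, wordLaw, Measure.pi_singleton, ENNReal.toReal_prod, letterLaw_singleton,
    ENNReal.toReal_ofReal (hα _)]

theorem sum_shRSK {n : ℕ} (k : Fin d) (w : Fin n → Fin d) :
    ∑ i ∈ Finset.Iic k, shRSK w i =
      largeCount k ((List.ofFn w).foldl queueInsert 0) + (List.ofFn w).countP (· ≤ k) := by
  rw [← topSize_insertionTableau_eq, topSize, ← sum_Iic_eq_sum_range]
  rfl

theorem excess_eq_wordSum {α : Fin d → ℝ} (hα : α ∈ stdSimplex ℝ (Fin d)) (n : ℕ) (k : Fin d) :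
    excess n k α = wordSum α n fun w => (largeCount k (w.foldl queueInsert 0) : ℝ) := by
  set D : List (Fin d) → ℝ := fun w => largeCount k (w.foldl queueInsert 0)
  set p : ℝ := ∑ i ∈ Finset.Iic k, α i
  have hshape (w : Fin n → Fin d) : ∑ i ∈ Finset.Iic k, (shRSK w i : ℝ) =
      D (List.ofFn w) + (List.ofFn w).countP (· ≤ k) := by
    rw [← Nat.cast_sum, sum_shRSK, Nat.cast_add]
  calc excess n k α
    _ = ∑ w, (wordLaw n α).real {w} • (∑ i ∈ Finset.Iic k, (shRSK w i : ℝ) - p * n) := by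
        rw [excess, schurWeyl, integral_map (Measurable.of_discrete).aemeasurable
          (Measurable.of_discrete).aestronglyMeasurable, integral_fintype Integrable.of_finite]
    _ = wordSum α n fun w => D w + ((w.countP (· ≤ k) : ℝ) + -(p * n)) := by
        rw [← sum_prod_ofFn_eq_wordSum]
        simp only [wordLaw_real_singleton hα.1, hshape, smul_eq_mul, add_assoc, sub_eq_add_neg]
    _ = wordSum α n D := by
        rw [wordSum_add, wordSum_add, wordSum_const hα.2, wordSum_countP hα.2]
        ring

theorem wordSum_ofReal {A : Type*} [Fintype A] {a : A → ℝ} (ha : 0 ≤ a) (n : ℕ)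
    {f : List A → ℝ} (hf : 0 ≤ f) :
    wordSum (fun x => ENNReal.ofReal (a x)) n (fun w => ENNReal.ofReal (f w)) =
      ENNReal.ofReal (wordSum a n f) := by
  have hnonneg (w : Fin n → A) : 0 ≤ ∏ i, a (w i) := Finset.prod_nonneg fun i _ => ha (w i)
  simp only [← sum_prod_ofFn_eq_wordSum]
  rw [ENNReal.ofReal_sum_of_nonneg fun w _ => mul_nonneg (hnonneg w) (hf _)]
  simp only [ENNReal.ofReal_mul (hnonneg _), ENNReal.ofReal_prod_of_nonneg fun _ _ => ha _]

theorem wordSum_nonneg {A : Type*} [Fintype A] {a : A → ℝ} (ha : 0 ≤ a) (n : ℕ) {f : List A → ℝ}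
    (hf : 0 ≤ f) : 0 ≤ wordSum a n f := by
  rw [← sum_prod_ofFn_eq_wordSum]
  exact Finset.sum_nonneg fun w _ => mul_nonneg (Finset.prod_nonneg fun i _ => ha _) (hf _)

theorem excess_nonneg {α : Fin d → ℝ} (hα : α ∈ stdSimplex ℝ (Fin d)) (n : ℕ) (k : Fin d) :
    0 ≤ excess n k α := by
  rw [excess_eq_wordSum hα]
  exact wordSum_nonneg hα.1 n fun w => Nat.cast_nonneg _

theorem ofReal_excess {α : Fin d → ℝ} (hα : α ∈ stdSimplex ℝ (Fin d)) (n : ℕ) (k : Fin d) :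
    ENNReal.ofReal (excess n k α) = wordSum (fun i => ENNReal.ofReal (α i)) n
      fun w => (largeCount k (w.foldl queueInsert 0) : ℝ≥0∞) := by
  rw [excess_eq_wordSum hα, ← wordSum_ofReal hα.1 n fun w => Nat.cast_nonneg _]
  simp only [ENNReal.ofReal_natCast]

theorem sum_ofReal_eq_one {α : Fin d → ℝ} (hα : α ∈ stdSimplex ℝ (Fin d)) :
    ∑ i, ENNReal.ofReal (α i) = 1 := by
  rw [← ENNReal.ofReal_sum_of_nonneg fun i _ => hα.1 i, hα.2, ENNReal.ofReal_one]

theorem monotone_excess {α : Fin d → ℝ} (hα : α ∈ stdSimplex ℝ (Fin d)) (k : Fin d) :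
    Monotone fun n => excess n k α := by
  intro m n hmn
  rw [← ENNReal.ofReal_le_ofReal_iff (excess_nonneg hα n k), ofReal_excess hα, ofReal_excess hα]
  exact monotone_wordSum (sum_ofReal_eq_one hα)
    (fun x w => by exact_mod_cast largeCount_le_cons k x w) hmn

theorem div_sub_nonneg_of_antitone {α : Fin d → ℝ} (h0 : 0 ≤ α) (hanti : Antitone α) {i j k : Fin d}
    (hi : i ∈ Finset.Iic k) (hj : j ∈ Finset.Ioi k) : 0 ≤ α j / (α i - α j) :=
  div_nonneg (h0 j)
    (sub_nonneg.2 (hanti ((Finset.mem_Iic.1 hi).trans_lt (Finset.mem_Ioi.1 hj)).le))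

theorem sum_ofReal_div_sub {α : Fin d → ℝ} (h0 : 0 ≤ α) (hanti : StrictAnti α) (k : Fin d) :
    ∑ i ∈ Finset.Iic k, ∑ j ∈ Finset.Ioi k,
        ENNReal.ofReal (α j) / (ENNReal.ofReal (α i) - ENNReal.ofReal (α j)) =
      ENNReal.ofReal (∑ i ∈ Finset.Iic k, ∑ j ∈ Finset.Ioi k, α j / (α i - α j)) := by
  rw [ENNReal.ofReal_sum_of_nonneg fun i hi => Finset.sum_nonneg fun j hj =>
    div_sub_nonneg_of_antitone h0 hanti.antitone hi hj]
  refine Finset.sum_congr rfl fun i hi => ?_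
  rw [ENNReal.ofReal_sum_of_nonneg fun j hj =>
    div_sub_nonneg_of_antitone h0 hanti.antitone hi hj]
  refine Finset.sum_congr rfl fun j hj => ?_
  have hlt : α j < α i := hanti ((Finset.mem_Iic.1 hi).trans_lt (Finset.mem_Ioi.1 hj))
  rw [ENNReal.ofReal_div_of_pos (sub_pos.2 hlt), ENNReal.ofReal_sub _ (h0 j)]

theorem tendsto_excess {α : Fin d → ℝ} (hα : α ∈ stdSimplex ℝ (Fin d)) (hanti : StrictAnti α)
    (k : Fin d) : Tendsto (fun n => excess n k α) atTop
      (𝓝 (∑ i ∈ Finset.Iic k, ∑ j ∈ Finset.Ioi k, α j / (α i - α j))) := by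
  set a : Fin d → ℝ≥0∞ := fun i => ENNReal.ofReal (α i)
  have ha : ∑ i, a i = 1 := sum_ofReal_eq_one hα
  have hfin (i : Fin d) : a i ≠ ∞ := ENNReal.ofReal_ne_top
  have ha_anti : StrictAnti a := fun i j hij =>
    (ENNReal.ofReal_lt_ofReal_iff ((hα.1 j).trans_lt (hanti hij))).2 (hanti hij)
  have hlim := (isStationaryLaw_geomWeight ha ha_anti).tendsto_wordSum ha
    (fun s hs => exists_foldl_queueInsert_eq hfin ha_anti hs)
    (f := fun s => (largeCount k s : ℝ≥0∞)) fun x w => by exact_mod_cast largeCount_le_cons k x w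
  rw [tsum_geomWeight_mul_largeCount hfin ha_anti, sum_ofReal_div_sub hα.1 hanti] at hlim
  have hreal := (ENNReal.tendsto_toReal ENNReal.ofReal_ne_top).comp hlim
  rw [ENNReal.toReal_ofReal (Finset.sum_nonneg fun i hi => Finset.sum_nonneg fun j hj =>
    div_sub_nonneg_of_antitone hα.1 hanti.antitone hi hj)] at hreal
  refine hreal.congr fun n => ?_
  rw [Function.comp_apply, ← ofReal_excess hα, ENNReal.toReal_ofReal (excess_nonneg hα n k)]

/-! ### Ties and the bound -/

theorem itwBound_eq_coe {α : Fin d → ℝ} {k : Fin d}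
    (h : ∀ i ∈ Finset.Iic k, ∀ j ∈ Finset.Ioi k, α i ≠ α j) :
    itwBound k α =
      ((∑ i ∈ Finset.Iic k, ∑ j ∈ Finset.Ioi k, α j / (α i - α j) : ℝ) : EReal) := by
  have coe_sum (s : Finset (Fin d)) (f : Fin d → ℝ) :
      ((∑ i ∈ s, f i : ℝ) : EReal) = ∑ i ∈ s, (f i : EReal) :=
    map_sum (⟨⟨Real.toEReal, EReal.coe_zero⟩, EReal.coe_add⟩ : ℝ →+ EReal) f s
  simp only [itwBound, coe_sum]
  exact Finset.sum_congr rfl fun i hi => Finset.sum_congr rfl fun j hj => if_neg (h i hi j hj)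

theorem itwBound_eq_top {α : Fin d → ℝ} (h0 : 0 ≤ α) (hanti : Antitone α) {k i j : Fin d}
    (hi : i ∈ Finset.Iic k) (hj : j ∈ Finset.Ioi k) (hij : α i = α j) : itwBound k α = ⊤ := by
  classical
  set f : Fin d → Fin d → EReal := fun i j => if α i = α j then ⊤ else ↑(α j / (α i - α j))
  have hf : ∀ i ∈ Finset.Iic k, ∀ j ∈ Finset.Ioi k, 0 ≤ f i j := by
    intro i hi j hj
    simp only [f]
    split_ifs
    · exact le_top
    · exact EReal.coe_nonneg.2 (div_sub_nonneg_of_antitone h0 hanti hi hj)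
  rw [eq_top_iff]
  calc ⊤
    _ = f i j := (if_pos hij).symm
    _ ≤ ∑ j ∈ Finset.Ioi k, f i j := Finset.single_le_sum (hf i hi) hj
    _ ≤ ∑ i ∈ Finset.Iic k, ∑ j ∈ Finset.Ioi k, f i j :=
        Finset.single_le_sum (f := fun i => ∑ j ∈ Finset.Ioi k, f i j)
          (fun i hi => Finset.sum_nonneg (hf i hi)) hi
    _ = itwBound k α := by rw [itwBound]

theorem exists_strictAnti_mem_stdSimplex (hd : 0 < d) :
    ∃ γ ∈ stdSimplex ℝ (Fin d), StrictAnti γ := by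
  set c : ℝ := ∑ i : Fin d, ((d : ℝ) - i)
  have hpos (i : Fin d) : 0 < (d : ℝ) - i := sub_pos.2 (by exact_mod_cast i.2)
  have hc : 0 < c := Finset.sum_pos (fun i _ => hpos i) ⟨⟨0, hd⟩, Finset.mem_univ _⟩
  refine ⟨fun i => (d - i) / c, ⟨fun i => (div_pos (hpos i) hc).le, ?_⟩, fun i j hij => ?_⟩
  · rw [← Finset.sum_div, div_self hc.ne']
  · have hij' : (i : ℝ) < j := by exact_mod_cast hij
    dsimp only
    gcongr

theorem mem_closure_strictAnti {α : Fin d → ℝ} (hα : α ∈ stdSimplex ℝ (Fin d)) (hanti : Antitone α)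
    (hd : 0 < d) : α ∈ closure {β | β ∈ stdSimplex ℝ (Fin d) ∧ StrictAnti β} := by
  obtain ⟨γ, hγ, hγ_anti⟩ := exists_strictAnti_mem_stdSimplex hd
  refine closure_mono ?_ (segment_subset_closure_openSegment (left_mem_segment ℝ α γ))
  rintro _ ⟨s, t, hs, ht, hst, rfl⟩
  refine ⟨convex_stdSimplex ℝ (Fin d) hα hγ hs.le ht.le hst, fun i j hij => ?_⟩
  exact add_lt_add_of_le_of_lt (mul_le_mul_of_nonneg_left (hanti hij.le) hs.le)
    (mul_lt_mul_of_pos_left (hγ_anti hij) ht)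

theorem excess_le {α : Fin d → ℝ} (hα : α ∈ stdSimplex ℝ (Fin d)) (hanti : Antitone α) {k : Fin d}
    (h : ∀ i ∈ Finset.Iic k, ∀ j ∈ Finset.Ioi k, α i ≠ α j) (n : ℕ) :
    excess n k α ≤ ∑ i ∈ Finset.Iic k, ∑ j ∈ Finset.Ioi k, α j / (α i - α j) := by
  rw [excess_eq_wordSum hα]
  refine ContinuousWithinAt.closure_le (mem_closure_strictAnti hα hanti k.pos)
    (continuous_wordSum n _).continuousWithinAt
    (g := fun β => ∑ i ∈ Finset.Iic k, ∑ j ∈ Finset.Ioi k, β j / (β i - β j)) ?_ ?_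
  · refine tendsto_finsetSum _ fun i hi => tendsto_finsetSum _ fun j hj => ?_
    exact ((continuous_apply j).continuousAt.div (by fun_prop)
      (sub_ne_zero.2 (h i hi j hj))).continuousWithinAt
  · rintro β ⟨hβ, hβ_anti⟩
    rw [← excess_eq_wordSum hβ]
    exact (monotone_excess hβ k).ge_of_tendsto (tendsto_excess hβ hβ_anti k) n

theorem excess_le_itwBound {α : Fin d → ℝ} (hα : α ∈ stdSimplex ℝ (Fin d)) (hanti : Antitone α)
    (k : Fin d) (n : ℕ) : (excess n k α : EReal) ≤ itwBound k α := by
  by_cases h : ∀ i ∈ Finset.Iic k, ∀ j ∈ Finset.Ioi k, α i ≠ α j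
  · rw [itwBound_eq_coe h, EReal.coe_le_coe_iff]
    exact excess_le hα hanti h n
  · push Not at h
    obtain ⟨i, hi, j, hj, hij⟩ := h
    exact le_top.trans_eq (itwBound_eq_top hα.1 hanti hi hj hij).symm

theorem tendsto_excess_itwBound {α : Fin d → ℝ} (hα : α ∈ stdSimplex ℝ (Fin d))
    (hanti : StrictAnti α) (k : Fin d) :
    Tendsto (fun n => (excess n k α : EReal)) atTop (𝓝 (itwBound k α)) := by
  rw [itwBound_eq_coe fun i hi j hj =>
    (hanti ((Finset.mem_Iic.1 hi).trans_lt (Finset.mem_Ioi.1 hj))).ne', EReal.tendsto_coe]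
  exact tendsto_excess hα hanti k

end Excess

theorem theorem1_general {d : ℕ} (α : Fin d → ℝ) (hα : α ∈ stdSimplex ℝ (Fin d)) (k : Fin d) :
    Monotone (fun n : ℕ => excess n k α) ∧
    (Antitone α →
      (∀ n : ℕ, ((excess n k α : ℝ) : EReal) ≤ itwBound k α) ∧
      (Function.Injective α →
        Tendsto (fun n : ℕ => ((excess n k α : ℝ) : EReal)) atTop (𝓝 (itwBound k α)))) :=
  ⟨monotone_excess hα k, fun hsorted => ⟨excess_le_itwBound hα hsorted k,
    fun hinj => tendsto_excess_itwBound hα (hsorted.strictAnti_of_injective hinj) k⟩⟩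

theorem theorem1 {d : ℕ} (α : Fin d → ℝ) (hα : α ∈ stdSimplex ℝ (Fin d)) (hsorted : Antitone α)
    (k : Fin d) :
    (∀ n : ℕ, ((excess n k α : ℝ) : EReal) ≤ itwBound k α) ∧
    (Function.Injective α →
      Monotone (fun n : ℕ => excess n k α) ∧
      Tendsto (fun n : ℕ => ((excess n k α : ℝ) : EReal)) atTop (𝓝 (itwBound k α))) := by
  obtain ⟨hmono, hbound⟩ := theorem1_general α hα k
  exact ⟨(hbound hsorted).1, fun hinj => ⟨hmono, (hbound hsorted).2 hinj⟩⟩
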